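/- **Theorem (Asymptotic distribution for the Adaptive Lasso).** Fix $p$, $\beta^*\in\mathbb R^p$, $\sigma\ge 0$ and $\gamma>0$, and let $S=\{j:\beta^*_j\ne0\}$, $S^c=\{j:\beta^*_j=0\}$. For each $n$ let $X=X_n\in\mathbb R^{n\times p}$ be a deterministic matrix with rows $x_i^\top$ and let $y=X\beta^*+\varepsilon$, where $\varepsilon=\varepsilon_n\in\mathbb R^n$ has i.i.d. $\mathcal N(0,\sigma^2)$ entries. Assume that, as $n\to\infty$, $\frac1nX^\top X\to C$ with $C$ positive definite, and $\frac1n\max_i\|x_i\|_2^2\to0$. Let $m=m(n)$ be integers, positive for all large $n$, with $n/m\to r_0$ for some $r_0\in[0,\infty)$. Let $\tilde\beta=\tilde\beta_n$ be an initial estimator (a random vector in $\mathbb R^p$) that is independent of $\varepsilon_n$ and is such that $\sqrt m(\tilde\beta-\beta^*)$ converges in distribution to a random vector $z$ (in particular, $\tilde\beta$ is $\sqrt m$-consistent). Let $W\sim\mathcal N(0,\sigma^2C)$ be independent of $z$. For $\lambda_n\ge0$, let $\hat\beta_n$ be an Adaptive Lasso estimator, that is, a random vector with $$\hat\beta_n\in\operatorname*{argmin}_{\beta\in\mathbb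 R^p}\Big\{\frac1n\|y-X\beta\|_2^2+\frac{\lambda_n}{n}\sum_{j=1}^p\frac{|\beta_j|}{|\tilde\beta_j|^{\gamma}}\Big\}\quad\text{almost surely.}$$ Here and below, $1/0=\infty$ and $0\cdot\infty=0$ in the penalty terms; thus, if $\lambda_n>0$ and $\tilde\beta_j=0$, then $\beta_j=0$ is forced. Put $\mathcal U=\{u\in\mathbb R^p: u_j=0\text{ for all }j\in S^c\}$. Then the following hold as $n\to\infty$; in each case the minimizer in the limit exists and is unique (almost surely in (i) and (ii)). (i) If $\sqrt{m^\gamma/n}\,\lambda_n\to\lambda_1\in[0,\infty)$, and, in case $\lambda_1=0$, $P(z_j=0)=0$ for every $j\in S^c$, then $$\sqrt n(\hat\beta_n-\beta^*)\overset d\to\operatorname*{argmin}_{u\in\mathbb R^p}\Big\{u^\top Cu-2u^\top W+\sum_{j\in S^c}\frac{\lambda_1}{|z_j|^\gamma}|u_j|\Big\}.$$ (ii) If $\sqrt{m^\gamma/n}\,\lambda_n\to\infty$ and $\lambda_n/\sqrt n\to\lambda_0\in[0,\infty)$, then $$\sqrt n(\hat\beta_n-\beta^*)\overset d\to\operatorname*{argmin}_{u\in\mathcal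 U}\Big\{u^\top Cu-2u^\top W+\lambda_0\sum_{j\in S}\frac{\operatorname{sgn}(\beta^*_j)}{|\beta^*_j|^\gamma}u_j\Big\}.$$ (iii) If $\lambda_n/\sqrt n\to\infty$ and $\lambda_n/n\to0$, then $$\frac n{\lambda_n}(\hat\beta_n-\beta^*)\overset d\to\operatorname*{argmin}_{u\in\mathcal U}\Big\{u^\top Cu+\sum_{j\in S}\frac{\operatorname{sgn}(\beta^*_j)}{|\beta^*_j|^\gamma}u_j\Big\}.$$ -/

import Mathlib

open MeasureTheory ProbabilityTheory Filter Topology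
open scoped ENNReal NNReal Matrix

namespace AdaptiveLasso

noncomputable section

/-- The set `S` of active coordinates of the true parameter. -/
def activeSet {p : ℕ} (βs : EuclideanSpace ℝ (Fin p)) : Finset (Fin p) := {j | βs j ≠ 0}

/-- The residual sum of squares `‖y - X β‖₂²`. -/
def rss {n p : ℕ} (X : Matrix (Fin n) (Fin p) ℝ) (y : Fin n → ℝ)
    (β : EuclideanSpace ℝ (Fin p)) : ℝ :=
  ∑ i, (y i - (X *ᵥ β.ofLp) i) ^ 2

/-- The weight `1 / |b| ^ γ` as an extended nonnegative number: it equals `∞` at `b = 0`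
(when `γ > 0`), so that no junk value of a real division by zero enters. -/
def weight (γ b : ℝ) : ℝ≥0∞ := (ENNReal.ofReal |b| ^ γ)⁻¹

/-- The Adaptive Lasso objective
`(1/n) ‖y - X β‖₂² + (lam/n) ∑ j, |β j| / |βt j| ^ γ`, with initial estimate `βt` and
regularization parameter `lam ≥ 0`.  It takes values in `[0, ∞]`: for `lam > 0`, a coordinate
with `βt j = 0` has infinite weight and so forces `β j = 0` (with `∞ * 0 = 0`). -/
def objective {n p : ℕ} (X : Matrix (Fin n) (Fin p) ℝ) (y : Fin n → ℝ) (lam γ : ℝ)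
    (βt β : EuclideanSpace ℝ (Fin p)) : ℝ≥0∞ :=
  ENNReal.ofReal (1 / n * rss X y β)
    + ENNReal.ofReal (lam / n) * ∑ j, weight γ (βt j) * ENNReal.ofReal |β j|

/-- `x` is a minimizer of `f` over `s`. -/
def IsArgmin {α β : Type*} [Preorder β] (f : α → β) (s : Set α) (x : α) : Prop :=
  x ∈ s ∧ ∀ y ∈ s, f x ≤ f y

/-- `x` is the only minimizer of `f` over `s`. -/
def IsUniqueArgmin {α β : Type*} [Preorder β] (f : α → β) (s : Set α) (x : α) : Prop :=
  IsArgmin f s x ∧ ∀ y, IsArgmin f s y → y = x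

/-- The set `𝒰 = {u | u j = 0 for every inactive coordinate j}`. -/
def activeSubspace {p : ℕ} (βs : EuclideanSpace ℝ (Fin p)) : Set (EuclideanSpace ℝ (Fin p)) :=
  {u | ∀ j ∉ activeSet βs, u j = 0}

/-- `uᵀ C u - 2 uᵀ w`. -/
def quad {p : ℕ} (C : Matrix (Fin p) (Fin p) ℝ) (w u : EuclideanSpace ℝ (Fin p)) : ℝ :=
  u.ofLp ⬝ᵥ (C *ᵥ u.ofLp) - 2 * (u.ofLp ⬝ᵥ w.ofLp)

/-- `uᵀ C u - 2 uᵀ w + ∑ j ∈ Sᶜ, (lam₁ / |z j| ^ γ) |u j|`, with values in `(-∞, ∞]`. -/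
def limitSmall {p : ℕ} (C : Matrix (Fin p) (Fin p) ℝ) (βs : EuclideanSpace ℝ (Fin p))
    (lam₁ γ : ℝ) (w z u : EuclideanSpace ℝ (Fin p)) : EReal :=
  ((quad C w u : ℝ) : EReal)
    + ((∑ j ∈ (activeSet βs)ᶜ,
        ENNReal.ofReal lam₁ * weight γ (z j) * ENNReal.ofReal |u j| : ℝ≥0∞) : EReal)

/-- `∑ j ∈ S, (sgn (βs j) / |βs j| ^ γ) u j`. -/
def activeDrift {p : ℕ} (βs : EuclideanSpace ℝ (Fin p)) (γ : ℝ)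
    (u : EuclideanSpace ℝ (Fin p)) : ℝ :=
  ∑ j ∈ activeSet βs, Real.sign (βs j) / |βs j| ^ γ * u j

end

end AdaptiveLasso

/-!
Write `β = βs + t u` with `t = 1 / √n` in the first two regimes and `t = lam / n` in the third. Up
to an additive constant and the factor `t ^ 2`, the objective becomes a quadratic form in `u` with
matrix `Xᵀ X / n` and random linear term, plus difference quotients of `|·|` in the active
coordinates, plus an `ℓ¹` penalty with weights in `[0, ∞]` in the inactive ones. Minimizers of such
problems depend continuously on their data, even as weights tend to `∞`, because the limit problem
is coercive and strictly convex. The score `Xᵀ ε / √n` and the rescaled initial error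
`√m (βt - βs)` converge jointly in distribution, so the extended continuous mapping theorem yields
the limit law. The regimes differ only in the limits of the linear term and of the rescaled weights:
on an inactive coordinate the weight tends to `lam₁ / |z j| ^ γ` in the first and to `∞` in the
other two.
-/

namespace AdaptiveLasso

section Argmin

lemma IsUniqueArgmin.lt {α R : Type*} [LinearOrder R] {f : α → R} {x y : α}
    (h : IsUniqueArgmin f Set.univ x) (hyx : y ≠ x) : f x < f y :=
  (h.1.2 y trivial).lt_of_not_ge fun hle =>
    hyx (h.2 y ⟨trivial, fun v hv => hle.trans (h.1.2 v hv)⟩)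

theorem eventually_isArgmin_mem_of_isCompact {ι E R : Type*} [TopologicalSpace E] [LinearOrder R]
    [DenselyOrdered R] {l : Filter ι} {f : ι → E → R} {f₀ : E → R} {K V : Set E} {u₀ : E}
    (hK : IsCompact K) (hfK : ∀ᶠ i in l, ∀ y, IsArgmin (f i) Set.univ y → y ∈ K)
    (hu₀ : IsUniqueArgmin f₀ Set.univ u₀)
    (hlower : ∀ x, ∀ b < f₀ x, ∀ᶠ q in l ×ˢ 𝓝 x, b < f q.1 q.2)
    (hupper : ∀ b > f₀ u₀, ∀ᶠ i in l, f i u₀ < b) (hV : V ∈ 𝓝 u₀) :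
    ∀ᶠ i in l, ∀ y, IsArgmin (f i) Set.univ y → y ∈ V := by
  have hlocal : ∀ x ∈ K \ interior V,
      ∀ᶠ q in l ×ˢ 𝓝 x, ¬ IsArgmin (f q.1) Set.univ q.2 := by
    rintro x ⟨-, hxV⟩
    have hxu : x ≠ u₀ := fun h => hxV (h ▸ mem_interior_iff_mem_nhds.2 hV)
    obtain ⟨b, hub, hbx⟩ := exists_between (hu₀.lt hxu)
    filter_upwards [hlower x b hbx, tendsto_fst.eventually (hupper b hub)] with q hbq huq hq
    exact ((hq.2 u₀ trivial).trans_lt huq).not_gt hbq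
  have hnear : ∀ᶠ q in l ×ˢ 𝓝ˢ (K \ interior V), ¬ IsArgmin (f q.1) Set.univ q.2 :=
    (hK.diff isOpen_interior).mem_prod_nhdsSet_of_forall hlocal
  filter_upwards [hfK, hnear.curry.mono fun i => subset_of_mem_nhdsSet] with i hiK hi y hy
  by_contra hyV
  exact hi ⟨hiK y hy, fun h => hyV (interior_subset h)⟩ hy

end Argmin

section QuadraticForm

variable {p : ℕ} {C : Matrix (Fin p) (Fin p) ℝ}

lemma continuous_quad :
    Continuous fun q : Matrix (Fin p) (Fin p) ℝ × EuclideanSpace ℝ (Fin p) ×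
      EuclideanSpace ℝ (Fin p) => quad q.1 q.2.1 q.2.2 := by
  unfold quad
  fun_prop

lemma quad_eq_sub_inner (A : Matrix (Fin p) (Fin p) ℝ) (w u : EuclideanSpace ℝ (Fin p)) :
    quad A w u = quad A 0 u - 2 * inner ℝ u w := by
  simp [quad, PiLp.inner_apply, dotProduct, mul_comm]

lemma quad_zero_smul (A : Matrix (Fin p) (Fin p) ℝ) (r : ℝ) (u : EuclideanSpace ℝ (Fin p)) :
    quad A 0 (r • u) = r ^ 2 * quad A 0 u := by
  simp only [quad, WithLp.ofLp_smul, Matrix.mulVec_smul, dotProduct_smul, smul_dotProduct,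
    smul_eq_mul, WithLp.ofLp_zero, dotProduct_zero]
  ring

lemma quad_midpoint (A : Matrix (Fin p) (Fin p) ℝ) (w u v : EuclideanSpace ℝ (Fin p)) :
    quad A w (midpoint ℝ u v) = (quad A w u + quad A w v) / 2 - quad A 0 (u - v) / 4 := by
  simp [midpoint_eq_smul_add, quad, Matrix.mulVec_smul, Matrix.mulVec_add, Matrix.mulVec_sub]
  ring

lemma quad_zero_pos (hC : C.PosDef) {u : EuclideanSpace ℝ (Fin p)} (hu : u ≠ 0) :
    0 < quad C 0 u := by
  have hu' : u.ofLp ≠ 0 := by simpa using hu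
  simpa [quad] using hC.dotProduct_mulVec_pos hu'

lemma exists_forall_mul_sq_norm_le_quad (hC : C.PosDef) :
    ∃ κ > 0, ∀ᶠ A in 𝓝 C, ∀ u : EuclideanSpace ℝ (Fin p), κ * ‖u‖ ^ 2 ≤ quad A 0 u := by
  have hcont : Continuous fun q : Matrix (Fin p) (Fin p) ℝ × EuclideanSpace ℝ (Fin p) =>
      quad q.1 0 q.2 :=
    continuous_quad.comp (f := fun q : Matrix (Fin p) (Fin p) ℝ × EuclideanSpace ℝ (Fin p) =>
      (q.1, 0, q.2)) (by fun_prop)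
  have hsphere := isCompact_sphere (0 : EuclideanSpace ℝ (Fin p)) 1
  obtain ⟨r, hr, hrC⟩ := hsphere.exists_forall_le' (f := quad C 0)
    (hcont.comp (Continuous.prodMk_right C)).continuousOn
    fun u hu => quad_zero_pos hC (ne_zero_of_mem_unit_sphere ⟨u, hu⟩)
  obtain ⟨κ, hκ, hκr⟩ := exists_between hr
  have hnear : ∀ᶠ A in 𝓝 C, ∀ u ∈ Metric.sphere (0 : EuclideanSpace ℝ (Fin p)) 1,
      κ < quad A 0 u :=
    hsphere.eventually_forall_of_forall_eventually fun u hu =>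
      hcont.continuousAt.eventually (lt_mem_nhds (hκr.trans_le (hrC u hu)))
  refine ⟨κ, hκ, hnear.mono fun A hA u => ?_⟩
  rcases eq_or_ne u 0 with rfl | hu
  · simp [quad]
  · have hunit := hA (‖u‖⁻¹ • u) (by simp [norm_smul, hu])
    rw [quad_zero_smul, inv_pow, inv_mul_eq_div, lt_div_iff₀ (by positivity)] at hunit
    exact hunit.le

end QuadraticForm

section Penalty

variable {p : ℕ}

/-- The weighted `ℓ¹` seminorm of the coordinates in `T`. A weight may be `∞`, and then it forces
its coordinate to vanish wherever the value is finite. -/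
noncomputable def weightedL1 (T : Finset (Fin p)) (c : Fin p → ℝ≥0∞)
    (u : EuclideanSpace ℝ (Fin p)) : ℝ≥0∞ :=
  ∑ j ∈ T, c j * ENNReal.ofReal |u j|

variable {T : Finset (Fin p)}

lemma weightedL1_zero (c : Fin p → ℝ≥0∞) : weightedL1 T c 0 = 0 := by
  simp [weightedL1]

lemma weightedL1_midpoint_le (c : Fin p → ℝ≥0∞) (u v : EuclideanSpace ℝ (Fin p)) :
    weightedL1 T c (midpoint ℝ u v) ≤ (weightedL1 T c u + weightedL1 T c v) / 2 := by
  simp only [weightedL1, ← Finset.sum_add_distrib, ENNReal.div_eq_inv_mul, Finset.mul_sum]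
  refine Finset.sum_le_sum fun j _ => ?_
  have habs : |midpoint ℝ u v j| ≤ 2⁻¹ * (|u j| + |v j|) := by
    rw [midpoint_eq_smul_add, PiLp.smul_apply, PiLp.add_apply, smul_eq_mul, abs_mul]
    norm_num [abs_add_le]
  calc c j * ENNReal.ofReal |midpoint ℝ u v j|
      ≤ c j * ENNReal.ofReal (2⁻¹ * (|u j| + |v j|)) := by gcongr
    _ = 2⁻¹ * (c j * ENNReal.ofReal |u j| + c j * ENNReal.ofReal |v j|) := by
      rw [ENNReal.ofReal_mul (by norm_num), ENNReal.ofReal_add (abs_nonneg _) (abs_nonneg _),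
        ENNReal.ofReal_inv_of_pos two_pos, ENNReal.ofReal_ofNat]
      ring

lemma tendsto_weightedL1 {ι : Type*} {l : Filter ι} {c : ι → Fin p → ℝ≥0∞} {c₀ : Fin p → ℝ≥0∞}
    (hc : ∀ j ∈ T, Tendsto (fun i => c i j) l (𝓝 (c₀ j))) (u : EuclideanSpace ℝ (Fin p)) :
    Tendsto (fun i => weightedL1 T (c i) u) l (𝓝 (weightedL1 T c₀ u)) :=
  tendsto_finsetSum T fun j hj =>
    ENNReal.Tendsto.mul_const (hc j hj) (Or.inr ENNReal.ofReal_ne_top)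

/-- The coordinates with `x j = 0` are dropped, as a product `c j * |u j|` may fail to converge
there when `c₀ j = ∞`. -/
lemma tendsto_weightedL1_support {ι : Type*} {l : Filter ι} {c : ι → Fin p → ℝ≥0∞}
    {c₀ : Fin p → ℝ≥0∞} {u : ι → EuclideanSpace ℝ (Fin p)} {x : EuclideanSpace ℝ (Fin p)}
    (hc : ∀ j ∈ T, Tendsto (fun i => c i j) l (𝓝 (c₀ j))) (hu : Tendsto u l (𝓝 x)) :
    Tendsto (fun i => weightedL1 {j ∈ T | x j ≠ 0} (c i) (u i)) l (𝓝 (weightedL1 T c₀ x)) := by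
  have hx : weightedL1 T c₀ x = weightedL1 {j ∈ T | x j ≠ 0} c₀ x :=
    (Finset.sum_filter_of_ne fun j _ => by contrapose!; intro hxj; simp [hxj]).symm
  rw [hx]
  refine tendsto_finsetSum _ fun j hj => ?_
  obtain ⟨hjT, hxj⟩ := Finset.mem_filter.1 hj
  have huj : Tendsto (fun i => u i j) l (𝓝 (x j)) :=
    ((EuclideanSpace.proj j : _ →L[ℝ] ℝ).continuous.tendsto x).comp hu
  exact ENNReal.Tendsto.mul (hc j hjT) (Or.inr ENNReal.ofReal_ne_top)
    (ENNReal.tendsto_ofReal huj.abs) (Or.inl (by simpa using hxj))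

lemma weightedL1_top_of_mem_activeSubspace {βs u : EuclideanSpace ℝ (Fin p)}
    (hu : u ∈ activeSubspace βs) : weightedL1 (activeSet βs)ᶜ (fun _ => ∞) u = 0 :=
  Finset.sum_eq_zero fun j hj => by simp [hu j (Finset.mem_compl.1 hj)]

lemma weightedL1_top_of_notMem_activeSubspace {βs u : EuclideanSpace ℝ (Fin p)}
    (hu : u ∉ activeSubspace βs) : weightedL1 (activeSet βs)ᶜ (fun _ => ∞) u = ∞ := by
  obtain ⟨j, hj, huj⟩ : ∃ j, j ∉ activeSet βs ∧ u j ≠ 0 := by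
    simpa [activeSubspace] using hu
  exact ENNReal.sum_eq_top.2 ⟨j, Finset.mem_compl.2 hj, ENNReal.top_mul (by simpa using huj)⟩

end Penalty

section LocalObjective

variable {p : ℕ} {βs : EuclideanSpace ℝ (Fin p)}

lemma mem_activeSet {j : Fin p} : j ∈ activeSet βs ↔ βs j ≠ 0 := by
  simp [activeSet]

lemma abs_dslope_abs_le_one (b s : ℝ) : |dslope (|·|) b s| ≤ 1 := by
  rcases eq_or_ne s b with rfl | hsb
  · have hlip : LipschitzWith 1 fun x : ℝ => |x| := lipschitzWith_one_norm
    simpa only [dslope_same, Real.norm_eq_abs, NNReal.coe_one] using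
      norm_deriv_le_of_lipschitz (x₀ := s) hlip
  · rw [dslope_of_ne _ hsb, slope_def_field, abs_div]
    exact div_le_one_of_le₀ (abs_abs_sub_abs_le _ _) (abs_nonneg _)

lemma deriv_abs_eq_sign {b : ℝ} (hb : b ≠ 0) : deriv (|·|) b = Real.sign b := by
  rw [(hasDerivAt_abs hb).deriv]
  rcases hb.lt_or_gt with hb | hb <;> simp [hb, Real.sign_of_neg, Real.sign_of_pos]

/-- The smooth part of the local problem at step `t`: the quadratic loss, and for each active
coordinate the difference quotient `(|βs j + t * u j| - |βs j|) / t` with weight `a j`. Writing it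
as `dslope (|·|) (βs j) (βs j + t * u j) * u j` makes `t = 0` the limit problem, in which the
quotient is `sgn (βs j) * u j`. -/
noncomputable def localSmooth (βs : EuclideanSpace ℝ (Fin p)) (A : Matrix (Fin p) (Fin p) ℝ)
    (w : EuclideanSpace ℝ (Fin p)) (t : ℝ) (a : Fin p → ℝ) (u : EuclideanSpace ℝ (Fin p)) : ℝ :=
  quad A w u + ∑ j ∈ activeSet βs, a j * (dslope (|·|) (βs j) (βs j + t * u j) * u j)

/-- The Adaptive Lasso objective in the local coordinate `u = (β - βs) / t`, up to an additive
constant and the factor `t ^ 2`. The value `∞` is kept for infinite weights, so that the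
convergence of the weights to finite or infinite limits is treated at once. -/
noncomputable def localObjective (βs : EuclideanSpace ℝ (Fin p)) (A : Matrix (Fin p) (Fin p) ℝ)
    (w : EuclideanSpace ℝ (Fin p)) (t : ℝ) (a : Fin p → ℝ) (c : Fin p → ℝ≥0∞)
    (u : EuclideanSpace ℝ (Fin p)) : EReal :=
  (localSmooth βs A w t a u : EReal) + (weightedL1 (activeSet βs)ᶜ c u : EReal)

variable {A C : Matrix (Fin p) (Fin p) ℝ} {w u v : EuclideanSpace ℝ (Fin p)} {t κ : ℝ}
  {a : Fin p → ℝ} {c : Fin p → ℝ≥0∞}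

lemma localSmooth_step_zero :
    localSmooth βs A w 0 a u =
      quad A w u + ∑ j ∈ activeSet βs, a j * (Real.sign (βs j) * u j) := by
  simp only [localSmooth, zero_mul, add_zero, dslope_same]
  congr 1
  exact Finset.sum_congr rfl fun j hj => by rw [deriv_abs_eq_sign (mem_activeSet.1 hj)]

lemma localSmooth_midpoint :
    localSmooth βs A w 0 a (midpoint ℝ u v) =
      (localSmooth βs A w 0 a u + localSmooth βs A w 0 a v) / 2 - quad A 0 (u - v) / 4 := by
  have hlinear : ∀ j, a j * (Real.sign (βs j) * midpoint ℝ u v j) =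
      (a j * (Real.sign (βs j) * u j) + a j * (Real.sign (βs j) * v j)) / 2 := fun j => by
    rw [midpoint_eq_smul_add, PiLp.smul_apply, PiLp.add_apply, smul_eq_mul, invOf_eq_inv]
    ring
  simp only [localSmooth_step_zero, quad_midpoint, hlinear, ← Finset.sum_div,
    Finset.sum_add_distrib]
  ring

lemma le_localSmooth (hA : κ * ‖u‖ ^ 2 ≤ quad A 0 u) :
    κ * ‖u‖ ^ 2 - (2 * ‖w‖ + ∑ j ∈ activeSet βs, |a j|) * ‖u‖ ≤ localSmooth βs A w t a u := by
  have hinner : inner ℝ u w ≤ ‖u‖ * ‖w‖ := real_inner_le_norm u w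
  have hterm : ∀ j ∈ activeSet βs,
      -(|a j| * ‖u‖) ≤ a j * (dslope (|·|) (βs j) (βs j + t * u j) * u j) := fun j _ => by
    refine (abs_le.1 ?_).1
    rw [abs_mul, abs_mul]
    gcongr
    exact (mul_le_of_le_one_left (abs_nonneg _) (abs_dslope_abs_le_one _ _)).trans
      (PiLp.norm_apply_le u j)
  have hsum := Finset.sum_le_sum hterm
  rw [Finset.sum_neg_distrib, ← Finset.sum_mul] at hsum
  rw [localSmooth, quad_eq_sub_inner]
  linarith

lemma localSmooth_le_localObjective :
    (localSmooth βs A w t a u : EReal) ≤ localObjective βs A w t a c u :=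
  le_add_of_nonneg_right (EReal.coe_ennreal_nonneg _)

lemma localObjective_zero : localObjective βs A w t a c 0 = 0 := by
  simp [localObjective, localSmooth, quad, weightedL1_zero]

lemma IsArgmin.localObjective_le_zero
    (h : IsArgmin (localObjective βs A w t a c) Set.univ u) :
    localObjective βs A w t a c u ≤ 0 :=
  (h.2 0 trivial).trans_eq localObjective_zero

lemma norm_le_of_localObjective_le_zero (hκ : 0 < κ)
    (hA : ∀ u : EuclideanSpace ℝ (Fin p), κ * ‖u‖ ^ 2 ≤ quad A 0 u)
    (hu : localObjective βs A w t a c u ≤ 0) :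
    ‖u‖ ≤ (2 * ‖w‖ + ∑ j ∈ activeSet βs, |a j|) / κ := by
  have hsmooth : localSmooth βs A w t a u ≤ 0 := by
    exact_mod_cast localSmooth_le_localObjective.trans hu
  have hbound := (le_localSmooth (hA u)).trans hsmooth
  rw [le_div_iff₀ hκ]
  by_contra! hlt
  have hpos : 0 < ‖u‖ := by
    refine (norm_nonneg u).lt_of_ne' fun h0 => ?_
    rw [h0, zero_mul] at hlt
    exact hlt.not_ge (by positivity)
  nlinarith

lemma localObjective_eq_coe (hu : weightedL1 (activeSet βs)ᶜ c u ≠ ∞) :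
    localObjective βs A w t a c u =
      ((localSmooth βs A w t a u + (weightedL1 (activeSet βs)ᶜ c u).toReal : ℝ) : EReal) := by
  rw [localObjective, EReal.coe_add, EReal.coe_ennreal_toReal hu]

end LocalObjective

section Stability

variable {p : ℕ} {ι : Type*} {l : Filter ι} {βs : EuclideanSpace ℝ (Fin p)}
  {A : ι → Matrix (Fin p) (Fin p) ℝ} {C : Matrix (Fin p) (Fin p) ℝ}
  {w u : ι → EuclideanSpace ℝ (Fin p)} {w₀ x : EuclideanSpace ℝ (Fin p)} {t : ι → ℝ}
  {a : ι → Fin p → ℝ} {a₀ : Fin p → ℝ} {c : ι → Fin p → ℝ≥0∞} {c₀ : Fin p → ℝ≥0∞}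

lemma tendsto_coe_add_coe_ennreal {f : ι → ℝ} {g : ι → ℝ≥0∞} {x : ℝ} {y : ℝ≥0∞}
    (hf : Tendsto f l (𝓝 x)) (hg : Tendsto g l (𝓝 y)) :
    Tendsto (fun i => (f i : EReal) + (g i : EReal)) l (𝓝 ((x : EReal) + (y : EReal))) :=
  (EReal.continuousAt_add (p := ((x : EReal), (y : EReal))) (.inl (EReal.coe_ne_top _))
    (.inl (EReal.coe_ne_bot _))).tendsto.comp
    (((continuous_coe_real_ereal.tendsto _).comp hf).prodMk_nhds
      ((continuous_coe_ennreal_ereal.tendsto _).comp hg))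

lemma tendsto_localSmooth (hA : Tendsto A l (𝓝 C)) (hw : Tendsto w l (𝓝 w₀))
    (ht : Tendsto t l (𝓝 0)) (ha : ∀ j ∈ activeSet βs, Tendsto (fun i => a i j) l (𝓝 (a₀ j)))
    (hu : Tendsto u l (𝓝 x)) :
    Tendsto (fun i => localSmooth βs (A i) (w i) (t i) (a i) (u i)) l
      (𝓝 (localSmooth βs C w₀ 0 a₀ x)) := by
  have hquad := (continuous_quad.tendsto (C, w₀, x)).comp (hA.prodMk_nhds (hw.prodMk_nhds hu))
  refine hquad.add (tendsto_finsetSum _ fun j hj => (ha j hj).mul ?_)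
  have huj : Tendsto (fun i => u i j) l (𝓝 (x j)) :=
    ((EuclideanSpace.proj j : _ →L[ℝ] ℝ).continuous.tendsto x).comp hu
  have hslope : ContinuousAt (dslope (|·|) (βs j)) (βs j + 0 * x j) := by
    rw [zero_mul, add_zero, continuousAt_dslope_same]
    exact (hasDerivAt_abs (mem_activeSet.1 hj)).differentiableAt
  exact (hslope.tendsto.comp ((ht.mul huj).const_add (βs j))).mul huj

lemma eventually_lt_localObjective (hA : Tendsto A l (𝓝 C)) (hw : Tendsto w l (𝓝 w₀))
    (ht : Tendsto t l (𝓝 0)) (ha : ∀ j ∈ activeSet βs, Tendsto (fun i => a i j) l (𝓝 (a₀ j)))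
    (hc : ∀ j ∈ (activeSet βs)ᶜ, Tendsto (fun i => c i j) l (𝓝 (c₀ j)))
    (hu : Tendsto u l (𝓝 x)) {b : EReal} (hb : b < localObjective βs C w₀ 0 a₀ c₀ x) :
    ∀ᶠ i in l, b < localObjective βs (A i) (w i) (t i) (a i) (c i) (u i) := by
  have hsum := tendsto_coe_add_coe_ennreal (tendsto_localSmooth hA hw ht ha hu)
    (tendsto_weightedL1_support hc hu)
  filter_upwards [hsum.eventually (lt_mem_nhds hb)] with i hi
  refine hi.trans_le (add_le_add_right (EReal.coe_ennreal_le_coe_ennreal_iff.2 ?_) _)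
  exact Finset.sum_le_sum_of_subset (Finset.filter_subset _ _)

lemma tendsto_localObjective (hA : Tendsto A l (𝓝 C)) (hw : Tendsto w l (𝓝 w₀))
    (ht : Tendsto t l (𝓝 0)) (ha : ∀ j ∈ activeSet βs, Tendsto (fun i => a i j) l (𝓝 (a₀ j)))
    (hc : ∀ j ∈ (activeSet βs)ᶜ, Tendsto (fun i => c i j) l (𝓝 (c₀ j)))
    (v : EuclideanSpace ℝ (Fin p)) :
    Tendsto (fun i => localObjective βs (A i) (w i) (t i) (a i) (c i) v) l
      (𝓝 (localObjective βs C w₀ 0 a₀ c₀ v)) :=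
  tendsto_coe_add_coe_ennreal (tendsto_localSmooth hA hw ht ha tendsto_const_nhds)
    (tendsto_weightedL1 hc v)

theorem eventually_isArgmin_localObjective_mem (hC : C.PosDef) (hA : Tendsto A l (𝓝 C))
    (hw : Tendsto w l (𝓝 w₀)) (ht : Tendsto t l (𝓝 0))
    (ha : ∀ j ∈ activeSet βs, Tendsto (fun i => a i j) l (𝓝 (a₀ j)))
    (hc : ∀ j ∈ (activeSet βs)ᶜ, Tendsto (fun i => c i j) l (𝓝 (c₀ j)))
    {u₀ : EuclideanSpace ℝ (Fin p)}
    (hu₀ : IsUniqueArgmin (localObjective βs C w₀ 0 a₀ c₀) Set.univ u₀)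
    {V : Set (EuclideanSpace ℝ (Fin p))} (hV : V ∈ 𝓝 u₀) :
    ∀ᶠ i in l, ∀ y,
      IsArgmin (localObjective βs (A i) (w i) (t i) (a i) (c i)) Set.univ y → y ∈ V := by
  obtain ⟨κ, hκ, hcoercive⟩ := exists_forall_mul_sq_norm_le_quad hC
  have hradius : Tendsto (fun i => (2 * ‖w i‖ + ∑ j ∈ activeSet βs, |a i j|) / κ) l
      (𝓝 ((2 * ‖w₀‖ + ∑ j ∈ activeSet βs, |a₀ j|) / κ)) :=
    ((hw.norm.const_mul 2).add (tendsto_finsetSum _ fun j hj => (ha j hj).abs)).div_const κ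
  obtain ⟨r, hr⟩ := exists_gt ((2 * ‖w₀‖ + ∑ j ∈ activeSet βs, |a₀ j|) / κ)
  refine eventually_isArgmin_mem_of_isCompact (isCompact_closedBall 0 r) ?_ hu₀ (fun x b hb => ?_)
    (fun b hb => (tendsto_localObjective hA hw ht ha hc u₀).eventually (gt_mem_nhds hb)) hV
  · filter_upwards [hA.eventually hcoercive, hradius.eventually_le_const hr] with i hAi hri y hy
    exact mem_closedBall_zero_iff.2
      ((norm_le_of_localObjective_le_zero hκ hAi hy.localObjective_le_zero).trans hri)
  · exact eventually_lt_localObjective (hA.comp tendsto_fst) (hw.comp tendsto_fst)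
      (ht.comp tendsto_fst) (fun j hj => (ha j hj).comp tendsto_fst)
      (fun j hj => (hc j hj).comp tendsto_fst) tendsto_snd hb

end Stability

section LimitProblem

variable {p : ℕ} {βs w : EuclideanSpace ℝ (Fin p)} {C : Matrix (Fin p) (Fin p) ℝ}
  {a : Fin p → ℝ} {c : Fin p → ℝ≥0∞}

lemma lowerSemicontinuous_localObjective :
    LowerSemicontinuous (localObjective βs C w 0 a c) := fun x _ hb =>
  eventually_lt_localObjective (l := 𝓝 x) (A := fun _ => C) (w := fun _ => w) (t := fun _ => 0)
    (a := fun _ => a) (c := fun _ => c) (u := id) tendsto_const_nhds tendsto_const_nhds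
    tendsto_const_nhds (fun _ _ => tendsto_const_nhds) (fun _ _ => tendsto_const_nhds) tendsto_id hb

lemma exists_isArgmin_localObjective (hC : C.PosDef) :
    ∃ u, IsArgmin (localObjective βs C w 0 a c) Set.univ u := by
  obtain ⟨κ, hκ, hcoercive⟩ := exists_forall_mul_sq_norm_le_quad hC
  obtain ⟨r, hr, hr₀⟩ : ∃ r, (2 * ‖w‖ + ∑ j ∈ activeSet βs, |a j|) / κ ≤ r ∧ 0 ≤ r :=
    ⟨_, le_rfl, by positivity⟩
  have hzero : (0 : EuclideanSpace ℝ (Fin p)) ∈ Metric.closedBall 0 r :=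
    Metric.mem_closedBall_self hr₀
  obtain ⟨u, -, hu⟩ := (lowerSemicontinuous_localObjective (βs := βs) (C := C) (w := w)
    (a := a) (c := c)).lowerSemicontinuousOn _ |>.exists_isMinOn ⟨0, hzero⟩
      (isCompact_closedBall 0 r)
  refine ⟨u, trivial, fun v _ => ?_⟩
  rcases le_or_gt (localObjective βs C w 0 a c v) 0 with hv | hv
  · exact hu (mem_closedBall_zero_iff.2
      ((norm_le_of_localObjective_le_zero hκ hcoercive.self_of_nhds hv).trans hr))
  · exact (hu hzero).trans (localObjective_zero.trans_le hv.le)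

lemma IsArgmin.weightedL1_ne_top {u : EuclideanSpace ℝ (Fin p)}
    (hu : IsArgmin (localObjective βs C w 0 a c) Set.univ u) :
    weightedL1 (activeSet βs)ᶜ c u ≠ ∞ := fun htop => by
  have hle := hu.localObjective_le_zero
  rw [localObjective, htop, EReal.coe_ennreal_top, EReal.coe_add_top] at hle
  exact hle.not_gt EReal.zero_lt_top

lemma localObjective_midpoint_lt (hC : C.PosDef) {u v : EuclideanSpace ℝ (Fin p)} (huv : u ≠ v)
    (hu : weightedL1 (activeSet βs)ᶜ c u ≠ ∞) (hv : weightedL1 (activeSet βs)ᶜ c v ≠ ∞)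
    (heq : localObjective βs C w 0 a c u = localObjective βs C w 0 a c v) :
    localObjective βs C w 0 a c (midpoint ℝ u v) < localObjective βs C w 0 a c u := by
  have hpenalty := weightedL1_midpoint_le (T := (activeSet βs)ᶜ) c u v
  have hfin : (weightedL1 (activeSet βs)ᶜ c u + weightedL1 (activeSet βs)ᶜ c v) / 2 ≠ ∞ :=
    ENNReal.div_ne_top (ENNReal.add_ne_top.2 ⟨hu, hv⟩) two_ne_zero
  have hreal := ENNReal.toReal_mono hfin hpenalty
  rw [ENNReal.toReal_div, ENNReal.toReal_add hu hv, ENNReal.toReal_ofNat] at hreal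
  rw [localObjective_eq_coe hu, localObjective_eq_coe hv, EReal.coe_eq_coe_iff] at heq
  rw [localObjective_eq_coe (ne_top_of_le_ne_top hfin hpenalty), localObjective_eq_coe hu,
    EReal.coe_lt_coe_iff, localSmooth_midpoint]
  linarith [quad_zero_pos hC (sub_ne_zero.2 huv)]

theorem exists_isUniqueArgmin_localObjective (hC : C.PosDef) :
    ∃ u, IsUniqueArgmin (localObjective βs C w 0 a c) Set.univ u := by
  obtain ⟨u, hu⟩ := exists_isArgmin_localObjective (βs := βs) (w := w) (a := a) (c := c) hC
  refine ⟨u, hu, fun v hv => ?_⟩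
  by_contra hvu
  have hlt := localObjective_midpoint_lt hC (Ne.symm hvu) hu.weightedL1_ne_top
    hv.weightedL1_ne_top ((hu.2 v trivial).antisymm (hv.2 u trivial))
  exact hlt.not_ge (hu.2 _ trivial)

/-- The minimizer of the limit problem, as a function of its random ingredients: the linear term
and the penalty weights. -/
noncomputable def limitArgmin (βs : EuclideanSpace ℝ (Fin p)) (hC : C.PosDef) (a : Fin p → ℝ)
    (w : EuclideanSpace ℝ (Fin p)) (c : Fin p → ℝ≥0∞) : EuclideanSpace ℝ (Fin p) :=
  (exists_isUniqueArgmin_localObjective (βs := βs) (w := w) (a := a) (c := c) hC).choose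

lemma isUniqueArgmin_limitArgmin (hC : C.PosDef) :
    IsUniqueArgmin (localObjective βs C w 0 a c) Set.univ (limitArgmin βs hC a w c) :=
  (exists_isUniqueArgmin_localObjective hC).choose_spec

lemma continuous_limitArgmin (hC : C.PosDef) :
    Continuous fun q : EuclideanSpace ℝ (Fin p) × (Fin p → ℝ≥0∞) =>
      limitArgmin βs hC a q.1 q.2 := by
  refine continuous_iff_continuousAt.2 fun q V hV => ?_
  have hc : ∀ j ∈ (activeSet βs)ᶜ, Tendsto
      (fun r : EuclideanSpace ℝ (Fin p) × (Fin p → ℝ≥0∞) => r.2 j) (𝓝 q) (𝓝 (q.2 j)) :=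
    fun j _ => ((continuous_apply j).comp continuous_snd).continuousAt
  have hmem := eventually_isArgmin_localObjective_mem (A := fun _ => C) (t := fun _ => 0)
    (a := fun _ => a) hC tendsto_const_nhds continuous_fst.continuousAt tendsto_const_nhds
    (fun _ _ => tendsto_const_nhds) hc (isUniqueArgmin_limitArgmin hC) hV
  exact hmem.mono fun r hr => hr _ (isUniqueArgmin_limitArgmin hC).1

end LimitProblem

section Rescaling

variable {p n : ℕ} {X : Matrix (Fin n) (Fin p) ℝ} {βs βt u : EuclideanSpace ℝ (Fin p)}
  {e : Fin n → ℝ} {lam γ t : ℝ}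

lemma abs_add_mul_eq (b t s : ℝ) :
    |b + t * s| = |b| + t * (dslope (|·|) b (b + t * s) * s) := by
  have h := sub_smul_dslope (|·|) b (b + t * s)
  rw [smul_eq_mul, add_sub_cancel_left] at h
  linear_combination -h

lemma rss_add_smul (X : Matrix (Fin n) (Fin p) ℝ) (βs u : EuclideanSpace ℝ (Fin p))
    (e : Fin n → ℝ) (t : ℝ) :
    rss X (X *ᵥ βs.ofLp + e) (βs + t • u) =
      e ⬝ᵥ e - 2 * t * (u.ofLp ⬝ᵥ Xᵀ *ᵥ e) + t ^ 2 * (u.ofLp ⬝ᵥ (Xᵀ * X) *ᵥ u.ofLp) := by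
  have hresidual : rss X (X *ᵥ βs.ofLp + e) (βs + t • u) =
      (e - t • (X *ᵥ u.ofLp)) ⬝ᵥ (e - t • (X *ᵥ u.ofLp)) := by
    simp only [rss, dotProduct, ← sq, WithLp.ofLp_add, WithLp.ofLp_smul, Matrix.mulVec_add,
      Matrix.mulVec_smul, Pi.add_apply, Pi.sub_apply, add_sub_add_left_eq_sub]
  have hcross : u.ofLp ⬝ᵥ Xᵀ *ᵥ e = e ⬝ᵥ X *ᵥ u.ofLp := by
    rw [Matrix.mulVec_transpose, dotProduct_comm, ← Matrix.dotProduct_mulVec]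
  have hgram : u.ofLp ⬝ᵥ (Xᵀ * X) *ᵥ u.ofLp = X *ᵥ u.ofLp ⬝ᵥ X *ᵥ u.ofLp := by
    rw [← Matrix.mulVec_mulVec, Matrix.mulVec_transpose, dotProduct_comm,
      ← Matrix.dotProduct_mulVec]
  rw [hresidual, hcross, hgram]
  simp only [sub_dotProduct, dotProduct_sub, smul_dotProduct, dotProduct_smul, smul_eq_mul,
    dotProduct_comm (X *ᵥ u.ofLp) e]
  ring

lemma loss_add_penalty_add_smul (hn : 0 < n) (ht : 0 < t) (ω : Fin p → ℝ) :
    1 / n * rss X (X *ᵥ βs.ofLp + e) (βs + t • u)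
        + lam / n * ∑ j ∈ activeSet βs, ω j * |(βs + t • u) j| =
      1 / n * (e ⬝ᵥ e) + lam / n * ∑ j ∈ activeSet βs, ω j * |βs j|
        + t ^ 2 * localSmooth βs ((1 / (n : ℝ)) • (Xᵀ * X))
            (WithLp.toLp 2 ((n * t)⁻¹ • Xᵀ *ᵥ e)) t (fun j => lam / (n * t) * ω j) u := by
  have hn' : (0 : ℝ) < n := by exact_mod_cast hn
  have hpenalty : lam / n * ∑ j ∈ activeSet βs, ω j * |(βs + t • u) j| =
      lam / n * ∑ j ∈ activeSet βs, ω j * |βs j| + t ^ 2 * ∑ j ∈ activeSet βs,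
        lam / (n * t) * ω j * (dslope (|·|) (βs j) (βs j + t * u j) * u j) := by
    simp only [Finset.mul_sum, ← Finset.sum_add_distrib, PiLp.add_apply, PiLp.smul_apply,
      smul_eq_mul]
    refine Finset.sum_congr rfl fun j _ => ?_
    rw [abs_add_mul_eq]
    field_simp [hn'.ne']
  have hloss : 1 / n * rss X (X *ᵥ βs.ofLp + e) (βs + t • u) = 1 / n * (e ⬝ᵥ e) +
      t ^ 2 * quad ((1 / (n : ℝ)) • (Xᵀ * X)) (WithLp.toLp 2 ((n * t)⁻¹ • Xᵀ *ᵥ e)) u := by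
    simp only [rss_add_smul, quad, Matrix.smul_mulVec, dotProduct_smul, smul_eq_mul]
    field_simp
    ring
  rw [hpenalty, hloss, localSmooth]
  ring

lemma weightedL1_compl_add_smul (hn : 0 < n) (hlam : 0 ≤ lam) (ht : 0 < t) (ω : Fin p → ℝ≥0∞) :
    ENNReal.ofReal (lam / n) * weightedL1 (activeSet βs)ᶜ ω (βs + t • u) =
      ENNReal.ofReal (t ^ 2) *
        weightedL1 (activeSet βs)ᶜ (fun j => ENNReal.ofReal (lam / (n * t)) * ω j) u := by
  have hn' : (0 : ℝ) < n := by exact_mod_cast hn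
  have hcoeff : ENNReal.ofReal (lam / n) * ENNReal.ofReal t =
      ENNReal.ofReal (t ^ 2) * ENNReal.ofReal (lam / (n * t)) := by
    rw [← ENNReal.ofReal_mul (by positivity), ← ENNReal.ofReal_mul (by positivity)]
    congr 1
    field_simp [hn'.ne']
  simp only [weightedL1, Finset.mul_sum]
  refine Finset.sum_congr rfl fun j hj => ?_
  have hβsj : βs j = 0 := by simpa [mem_activeSet] using hj
  have hstep : ENNReal.ofReal |(βs + t • u) j| = ENNReal.ofReal t * ENNReal.ofReal |u j| := by
    simp [hβsj, abs_mul, abs_of_pos ht, ENNReal.ofReal_mul ht.le]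
  rw [hstep, mul_left_comm (ω j), ← mul_assoc, hcoeff]
  ring

lemma objective_eq_ofReal_add {y : Fin n → ℝ} {β : EuclideanSpace ℝ (Fin p)} (hlam : 0 ≤ lam)
    {T : Finset (Fin p)} (hT : ∀ j ∈ T, weight γ (βt j) ≠ ∞) :
    objective X y lam γ βt β =
      ENNReal.ofReal (1 / n * rss X y β + lam / n * ∑ j ∈ T, (weight γ (βt j)).toReal * |β j|)
        + ENNReal.ofReal (lam / n) * weightedL1 Tᶜ (fun j => weight γ (βt j)) β := by
  have hrss : 0 ≤ rss X y β := Finset.sum_nonneg fun _ _ => sq_nonneg _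
  have hfinite : ∑ j ∈ T, weight γ (βt j) * ENNReal.ofReal |β j| =
      ENNReal.ofReal (∑ j ∈ T, (weight γ (βt j)).toReal * |β j|) := by
    rw [ENNReal.ofReal_sum_of_nonneg fun _ _ => by positivity]
    refine Finset.sum_congr rfl fun j hj => ?_
    rw [ENNReal.ofReal_mul ENNReal.toReal_nonneg, ENNReal.ofReal_toReal (hT j hj)]
  rw [objective, ← Finset.sum_add_sum_compl T, hfinite, mul_add, ← add_assoc,
    ← ENNReal.ofReal_mul (by positivity), ← ENNReal.ofReal_add (by positivity) (by positivity)]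
  rfl

theorem objective_add_smul (hn : 0 < n) (hlam : 0 ≤ lam) (ht : 0 < t)
    (hβt : ∀ j ∈ activeSet βs, weight γ (βt j) ≠ ∞) :
    (objective X (X *ᵥ βs.ofLp + e) lam γ βt (βs + t • u) : EReal) =
      ((1 / n * (e ⬝ᵥ e) + lam / n * ∑ j ∈ activeSet βs, (weight γ (βt j)).toReal * |βs j| : ℝ) :
          EReal)
        + ((t ^ 2 : ℝ) : EReal) * localObjective βs ((1 / (n : ℝ)) • (Xᵀ * X))
            (WithLp.toLp 2 ((n * t)⁻¹ • Xᵀ *ᵥ e)) t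
            (fun j => lam / (n * t) * (weight γ (βt j)).toReal)
            (fun j => ENNReal.ofReal (lam / (n * t)) * weight γ (βt j)) u := by
  have hnonneg : 0 ≤ 1 / n * rss X (X *ᵥ βs.ofLp + e) (βs + t • u)
      + lam / n * ∑ j ∈ activeSet βs, (weight γ (βt j)).toReal * |(βs + t • u) j| := by
    have hrss : 0 ≤ rss X (X *ᵥ βs.ofLp + e) (βs + t • u) :=
      Finset.sum_nonneg fun _ _ => sq_nonneg _
    positivity
  have hsq : (0 : EReal) ≤ ((t ^ 2 : ℝ) : EReal) := by exact_mod_cast sq_nonneg t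
  rw [objective_eq_ofReal_add hlam hβt, weightedL1_compl_add_smul hn hlam ht,
    EReal.coe_ennreal_add, EReal.coe_ennreal_ofReal, max_eq_left hnonneg,
    loss_add_penalty_add_smul hn ht, EReal.coe_ennreal_mul, EReal.coe_ennreal_ofReal,
    max_eq_left (sq_nonneg t), localObjective,
    EReal.left_distrib_of_nonneg_of_ne_top hsq (EReal.coe_ne_top _), ← EReal.coe_mul, ← add_assoc,
    ← EReal.coe_add]

theorem isArgmin_localObjective_of_objective (hn : 0 < n) (hlam : 0 ≤ lam) (ht : 0 < t)
    (hβt : ∀ j ∈ activeSet βs, weight γ (βt j) ≠ ∞)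
    (h : IsArgmin (objective X (X *ᵥ βs.ofLp + e) lam γ βt) Set.univ (βs + t • u)) :
    IsArgmin (localObjective βs ((1 / (n : ℝ)) • (Xᵀ * X))
      (WithLp.toLp 2 ((n * t)⁻¹ • Xᵀ *ᵥ e)) t (fun j => lam / (n * t) * (weight γ (βt j)).toReal)
      (fun j => ENNReal.ofReal (lam / (n * t)) * weight γ (βt j))) Set.univ u := by
  refine ⟨trivial, fun v _ => ?_⟩
  have hle : (objective X (X *ᵥ βs.ofLp + e) lam γ βt (βs + t • u) : EReal) ≤
      objective X (X *ᵥ βs.ofLp + e) lam γ βt (βs + t • v) :=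
    EReal.coe_ennreal_le_coe_ennreal_iff.2 (h.2 _ trivial)
  rw [objective_add_smul hn hlam ht hβt, objective_add_smul hn hlam ht hβt] at hle
  have hscaled := mul_le_mul_of_nonneg_left
    ((EReal.addLECancellable_coe _).add_le_add_iff_left.1 hle)
    (EReal.coe_nonneg.2 (inv_nonneg.2 (sq_nonneg t)))
  rwa [← mul_assoc, ← mul_assoc, ← EReal.coe_mul, inv_mul_cancel₀ (pow_pos ht 2).ne', EReal.coe_one,
    one_mul, one_mul] at hscaled

end Rescaling

section LimitObjectives

variable {p : ℕ} {βs w : EuclideanSpace ℝ (Fin p)} {C : Matrix (Fin p) (Fin p) ℝ}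

lemma IsUniqueArgmin.of_ereal {α : Type*} {f : α → ℝ} {g : α → EReal} {s : Set α} {x : α}
    (hs : s.Nonempty) (hfg : ∀ y ∈ s, g y = f y) (htop : ∀ y ∉ s, g y = ⊤)
    (h : IsUniqueArgmin g Set.univ x) : IsUniqueArgmin f s x := by
  have hle : ∀ y ∈ s, (∀ v ∈ s, f y ≤ f v) ↔ ∀ v, g y ≤ g v := fun y hy => by
    refine ⟨fun hf v => ?_, fun hg v hv => ?_⟩
    · by_cases hv : v ∈ s
      · simpa [hfg y hy, hfg v hv] using hf v hv
      · exact (htop v hv).symm ▸ le_top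
    · simpa [hfg y hy, hfg v hv] using hg v
  have hx : x ∈ s := by
    obtain ⟨v, hv⟩ := hs
    by_contra hx
    simpa [htop x hx, hfg v hv] using h.1.2 v trivial
  exact ⟨⟨hx, (hle x hx).2 fun v => h.1.2 v trivial⟩,
    fun y hy => h.2 y ⟨trivial, fun v _ => (hle y hy.1).1 hy.2 v⟩⟩

lemma limitSmall_eq_localObjective (lam₁ γ : ℝ) (z : EuclideanSpace ℝ (Fin p)) :
    limitSmall C βs lam₁ γ w z =
      localObjective βs C w 0 0 fun j => ENNReal.ofReal lam₁ * weight γ (z j) := by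
  funext u
  simp [limitSmall, localObjective, localSmooth, weightedL1]

lemma localSmooth_step_zero_eq_add_activeDrift (κ γ : ℝ) (u : EuclideanSpace ℝ (Fin p)) :
    localSmooth βs C w 0 (fun j => κ * (|βs j| ^ γ)⁻¹) u =
      quad C w u + κ * activeDrift βs γ u := by
  rw [localSmooth_step_zero, activeDrift, Finset.mul_sum]
  congr 1
  exact Finset.sum_congr rfl fun j _ => by ring

lemma isUniqueArgmin_activeSubspace {κ γ : ℝ} {u : EuclideanSpace ℝ (Fin p)}
    (h : IsUniqueArgmin (localObjective βs C w 0 (fun j => κ * (|βs j| ^ γ)⁻¹) fun _ => ∞)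
      Set.univ u) :
    IsUniqueArgmin (fun v => quad C w v + κ * activeDrift βs γ v) (activeSubspace βs) u := by
  refine h.of_ereal ⟨0, fun _ _ => rfl⟩ (fun v hv => ?_) fun v hv => ?_
  · rw [localObjective, weightedL1_top_of_mem_activeSubspace hv, EReal.coe_ennreal_zero, add_zero,
      localSmooth_step_zero_eq_add_activeDrift]
  · rw [localObjective, weightedL1_top_of_notMem_activeSubspace hv, EReal.coe_ennreal_top,
      EReal.coe_add_top]

end LimitObjectives

section Probability

lemma mem_of_mem_iInter_closure_of_relation {E F : Type*} [TopologicalSpace E]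
    [TopologicalSpace F] {R : ℕ → E → F → Prop} {K : Set F} {x : E} {u : F} (hK : IsClosed K)
    (hR : ∀ V ∈ 𝓝 u, ∀ᶠ q in atTop ×ˢ 𝓝 x, ∀ y, R q.1 q.2 y → y ∈ V)
    (hx : ∀ k, x ∈ closure (⋃ n ≥ k, {x | ∃ y ∈ K, R n x y})) : u ∈ K := by
  by_contra huK
  obtain ⟨s, hs, t, ht, hst⟩ := Filter.mem_prod_iff.1 (hR Kᶜ (hK.isOpen_compl.mem_nhds huK))
  obtain ⟨k, hk⟩ := Filter.mem_atTop_sets.1 hs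
  obtain ⟨x', hx't, hx'⟩ := mem_closure_iff_nhds.1 (hx k) t ht
  obtain ⟨n, hn, y, hyK, hy⟩ := Set.mem_iUnion₂.1 hx'
  exact hst (Set.mk_mem_prod (hk n hn) hx't) y hy hyK

section ContinuousMapping

variable {E F Ω' : Type*} {Ω : ℕ → Type*} [∀ n, MeasurableSpace (Ω n)]
  {P : (n : ℕ) → Measure (Ω n)} [∀ n, IsProbabilityMeasure (P n)]
  [MeasurableSpace Ω'] {Q : Measure Ω'} [IsProbabilityMeasure Q]
  [TopologicalSpace E] [MeasurableSpace E] [OpensMeasurableSpace E] [HasOuterApproxClosed E]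
  [TopologicalSpace F] [MeasurableSpace F] [OpensMeasurableSpace F]
  {X : (n : ℕ) → Ω n → E} {Z : Ω' → E} {Y : (n : ℕ) → Ω n → F} {U : Ω' → F}
  {R : ℕ → E → F → Prop} {K : Set F}

lemma limsup_map_le_map_closure_of_relation (hX : TendstoInDistribution X atTop Z P Q)
    (hY : ∀ n, AEMeasurable (Y n) (P n))
    (hXY : ∀ᶠ n in atTop, ∀ᵐ ω ∂(P n), R n (X n ω) (Y n ω)) (hK : IsClosed K) (k : ℕ) :
    limsup (fun n => (P n).map (Y n) K) atTop ≤
      Q.map Z (closure (⋃ n ≥ k, {x | ∃ y ∈ K, R n x y})) := by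
  have hportmanteau := ProbabilityMeasure.limsup_measure_closed_le_of_tendsto hX.tendsto
    (F := closure (⋃ n ≥ k, {x | ∃ y ∈ K, R n x y})) isClosed_closure
  refine le_trans (limsup_le_limsup ?_) hportmanteau
  filter_upwards [hXY, eventually_ge_atTop k] with n hn hnk
  change (P n).map (Y n) K ≤ (P n).map (X n) _
  rw [Measure.map_apply_of_aemeasurable (hY n) hK.measurableSet,
    Measure.map_apply_of_aemeasurable (hX.forall_aemeasurable n) isClosed_closure.measurableSet]
  refine measure_mono_ae ?_
  filter_upwards [hn] with ω hω hωK
  exact subset_closure (Set.mem_biUnion hnk ⟨Y n ω, hωK, hω⟩)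

/-- The extended continuous mapping theorem, for set-valued maps: minimizers of random functions
are related to the data of the problem without being a measurable function of them. -/
theorem tendstoInDistribution_of_relation (hX : TendstoInDistribution X atTop Z P Q)
    (hY : ∀ n, AEMeasurable (Y n) (P n)) (hU : AEMeasurable U Q)
    (hXY : ∀ᶠ n in atTop, ∀ᵐ ω ∂(P n), R n (X n ω) (Y n ω))
    (hR : ∀ᵐ ω ∂Q, ∀ V ∈ 𝓝 (U ω), ∀ᶠ q in atTop ×ˢ 𝓝 (Z ω), ∀ y, R q.1 q.2 y → y ∈ V) :
    TendstoInDistribution Y atTop U P Q := by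
  refine ⟨hY, hU, tendsto_of_forall_isClosed_limsup_le' fun K hK => ?_⟩
  set G : ℕ → Set E := fun k => closure (⋃ n ≥ k, {x | ∃ y ∈ K, R n x y})
  have hGanti : Antitone G := fun i j hij => closure_mono <|
    Set.biUnion_subset_biUnion_left fun n hn => le_trans hij hn
  have hGmeas : ∀ k, MeasurableSet (G k) := fun k => isClosed_closure.measurableSet
  have := Measure.isProbabilityMeasure_map hX.aemeasurable_limit
  have hGlim : Tendsto (fun k => Q.map Z (G k)) atTop (𝓝 (Q.map Z (⋂ k, G k))) :=
    tendsto_measure_iInter_atTop (fun k => (hGmeas k).nullMeasurableSet) hGanti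
      ⟨0, measure_ne_top _ _⟩
  refine (ge_of_tendsto' hGlim (limsup_map_le_map_closure_of_relation hX hY hXY hK)).trans ?_
  change Q.map Z (⋂ k, G k) ≤ Q.map U K
  rw [Measure.map_apply_of_aemeasurable hU hK.measurableSet,
    Measure.map_apply_of_aemeasurable hX.aemeasurable_limit (MeasurableSet.iInter hGmeas)]
  refine measure_mono_ae ?_
  filter_upwards [hR] with ω hω hωG
  exact mem_of_mem_iInter_closure_of_relation hK hω (Set.mem_iInter.1 hωG)

end ContinuousMapping

theorem tendstoInDistribution_prodMk_of_indepFun {ι E F Ω' : Type*} {l : Filter ι} {Ω : ι → Type*}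
    [∀ i, MeasurableSpace (Ω i)] {P : (i : ι) → Measure (Ω i)} [∀ i, IsProbabilityMeasure (P i)]
    [MeasurableSpace Ω'] {Q : Measure Ω'} [IsProbabilityMeasure Q]
    [TopologicalSpace E] [MeasurableSpace E] [OpensMeasurableSpace E]
    [SecondCountableTopology E] [TopologicalSpace.PseudoMetrizableSpace E]
    [TopologicalSpace F] [MeasurableSpace F] [OpensMeasurableSpace F]
    [SecondCountableTopology F] [TopologicalSpace.PseudoMetrizableSpace F]
    {X : (i : ι) → Ω i → E} {Z : Ω' → E} {Y : (i : ι) → Ω i → F} {U : Ω' → F}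
    (hX : TendstoInDistribution X l Z P Q) (hY : TendstoInDistribution Y l U P Q)
    (hXY : ∀ i, IndepFun (X i) (Y i) (P i)) (hZU : IndepFun Z U Q) :
    TendstoInDistribution (fun i ω => (X i ω, Y i ω)) l (fun ω => (Z ω, U ω)) P Q := by
  refine ⟨fun i => (hX.forall_aemeasurable i).prodMk (hY.forall_aemeasurable i),
    hX.aemeasurable_limit.prodMk hY.aemeasurable_limit, ?_⟩
  have hprod := (ProbabilityMeasure.continuous_prod.tendsto _).comp
    (hX.tendsto.prodMk_nhds hY.tendsto)
  have hlimit : Q.map (fun ω => (Z ω, U ω)) = (Q.map Z).prod (Q.map U) :=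
    (indepFun_iff_map_prod_eq_prod_map_map hX.aemeasurable_limit hY.aemeasurable_limit).1 hZU
  have hlaw : ∀ i, (P i).map (fun ω => (X i ω, Y i ω)) = ((P i).map (X i)).prod ((P i).map (Y i)) :=
    fun i => (indepFun_iff_map_prod_eq_prod_map_map (hX.forall_aemeasurable i)
      (hY.forall_aemeasurable i)).1 (hXY i)
  refine (hprod.congr fun i => Subtype.ext (hlaw i).symm).trans (le_of_eq (congrArg 𝓝 ?_))
  exact Subtype.ext hlimit.symm

variable {p : ℕ}

lemma continuous_toLp_mulVec {m n : Type*} [Fintype n] (B : Matrix m n ℝ) :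
    Continuous fun e : n → ℝ => WithLp.toLp 2 (B *ᵥ e) :=
  (PiLp.continuous_toLp 2 _).comp (continuous_const.matrix_mulVec continuous_id)

lemma charFun_map_toLp_mulVec {m n Ω : Type*} [Fintype m] [Fintype n] [MeasurableSpace Ω]
    {P : Measure Ω} {e : Ω → n → ℝ} (he : AEMeasurable e P) (B : Matrix m n ℝ)
    (s : EuclideanSpace ℝ m) :
    charFun (P.map fun ω => WithLp.toLp 2 (B *ᵥ e ω)) s =
      charFun (P.map fun ω => WithLp.toLp 2 (e ω)) (WithLp.toLp 2 (Bᵀ *ᵥ s.ofLp)) := by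
  have hinner : ∀ ω, inner ℝ (WithLp.toLp 2 (B *ᵥ e ω)) s =
      inner ℝ (WithLp.toLp 2 (e ω)) (WithLp.toLp 2 (Bᵀ *ᵥ s.ofLp)) := fun ω => by
    simp only [EuclideanSpace.inner_eq_star_dotProduct, star_trivial]
    rw [Matrix.dotProduct_mulVec, Matrix.mulVec_transpose]
  have htoLp : AEMeasurable (fun ω => WithLp.toLp 2 (e ω)) P :=
    (WithLp.measurable_toLp 2 _).comp_aemeasurable he
  have hmulVec : AEMeasurable (fun ω => WithLp.toLp 2 (B *ᵥ e ω)) P :=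
    (continuous_toLp_mulVec B).measurable.comp_aemeasurable he
  rw [charFun_apply, charFun_apply, integral_map hmulVec (by fun_prop),
    integral_map htoLp (by fun_prop)]
  simp only [hinner]

lemma charFun_map_toLp_of_iIndepFun_gaussianReal {n Ω : Type*} [Fintype n] [MeasurableSpace Ω]
    {P : Measure Ω} [IsProbabilityMeasure P] {v : ℝ≥0} {e : Ω → n → ℝ}
    (hindep : iIndepFun (fun i ω => e ω i) P)
    (hlaw : ∀ i, HasLaw (fun ω => e ω i) (gaussianReal 0 v) P) (s : EuclideanSpace ℝ n) :
    charFun (P.map fun ω => WithLp.toLp 2 (e ω)) s = Complex.exp (-(v * ‖s‖ ^ 2 : ℝ) / 2) := by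
  rw [(iIndepFun_iff_charFun_pi fun i => (hlaw i).aemeasurable).1 hindep s]
  simp_rw [(hlaw _).map_eq, charFun_gaussianReal, ← Complex.exp_sum, EuclideanSpace.real_norm_sq_eq]
  push_cast
  rw [Finset.mul_sum, ← Finset.sum_neg_distrib, Finset.sum_div]
  congr 1
  refine Finset.sum_congr rfl fun i _ => ?_
  simp
  ring

lemma charFun_map_toLp_mulVec_of_iIndepFun_gaussianReal {m n Ω : Type*} [Fintype m] [Fintype n]
    [MeasurableSpace Ω] {P : Measure Ω} [IsProbabilityMeasure P] {v : ℝ≥0} {e : Ω → n → ℝ}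
    (hindep : iIndepFun (fun i ω => e ω i) P)
    (hlaw : ∀ i, HasLaw (fun ω => e ω i) (gaussianReal 0 v) P) (B : Matrix m n ℝ)
    (s : EuclideanSpace ℝ m) :
    charFun (P.map fun ω => WithLp.toLp 2 (B *ᵥ e ω)) s =
      Complex.exp (-(v * (s.ofLp ⬝ᵥ (B * Bᵀ) *ᵥ s.ofLp) : ℝ) / 2) := by
  have hnorm : ‖WithLp.toLp 2 (Bᵀ *ᵥ s.ofLp)‖ ^ 2 = s.ofLp ⬝ᵥ (B * Bᵀ) *ᵥ s.ofLp := by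
    rw [EuclideanSpace.real_norm_sq_eq, ← Matrix.mulVec_mulVec, Matrix.dotProduct_mulVec,
      ← Matrix.mulVec_transpose]
    simp only [dotProduct, sq]
  rw [charFun_map_toLp_mulVec (aemeasurable_pi_lambda _ fun i => (hlaw i).aemeasurable),
    charFun_map_toLp_of_iIndepFun_gaussianReal hindep hlaw, hnorm]

theorem tendstoInDistribution_toLp_mulVec_gaussian {v : ℝ≥0}
    {B : (n : ℕ) → Matrix (Fin p) (Fin n) ℝ} {C : Matrix (Fin p) (Fin p) ℝ} (hC : C.PosSemidef)
    (hB : Tendsto (fun n => B n * (B n)ᵀ) atTop (𝓝 C))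
    {Ω : ℕ → Type*} [∀ n, MeasurableSpace (Ω n)] {P : (n : ℕ) → Measure (Ω n)}
    [∀ n, IsProbabilityMeasure (P n)] {e : (n : ℕ) → Ω n → Fin n → ℝ}
    (hindep : ∀ n, iIndepFun (fun i ω => e n ω i) (P n))
    (hlaw : ∀ n i, HasLaw (fun ω => e n ω i) (gaussianReal 0 v) (P n))
    {Ω' : Type*} [MeasurableSpace Ω'] {Q : Measure Ω'} [IsProbabilityMeasure Q]
    {W : Ω' → EuclideanSpace ℝ (Fin p)}
    (hW : HasLaw W (multivariateGaussian 0 ((v : ℝ) • C)) Q) :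
    TendstoInDistribution (fun n ω => WithLp.toLp 2 (B n *ᵥ e n ω)) atTop W P Q := by
  refine ⟨fun n => (continuous_toLp_mulVec (B n)).measurable.comp_aemeasurable
      (aemeasurable_pi_lambda _ fun i => (hlaw n i).aemeasurable), hW.aemeasurable,
    ProbabilityMeasure.tendsto_iff_tendsto_charFun.2 fun s => ?_⟩
  have hlimit : charFun (Q.map W) s =
      Complex.exp (-(v * (s.ofLp ⬝ᵥ C *ᵥ s.ofLp) : ℝ) / 2) := by
    rw [hW.map_eq, charFun_multivariateGaussian (hC.smul v.coe_nonneg)]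
    simp [Matrix.smul_mulVec]
    ring_nf
  have hcont : Continuous fun A : Matrix (Fin p) (Fin p) ℝ =>
      Complex.exp (-(v * (s.ofLp ⬝ᵥ A *ᵥ s.ofLp) : ℝ) / 2) := by
    have hform : Continuous fun A : Matrix (Fin p) (Fin p) ℝ => s.ofLp ⬝ᵥ A *ᵥ s.ofLp :=
      continuous_const.dotProduct (continuous_id.matrix_mulVec continuous_const)
    fun_prop
  change Tendsto (fun n => charFun ((P n).map _) s) atTop (𝓝 (charFun (Q.map W) s))
  simp_rw [hlimit,
    charFun_map_toLp_mulVec_of_iIndepFun_gaussianReal (hindep _) (hlaw _) (B _) s]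
  exact (hcont.tendsto C).comp hB

end Probability

section Weights

variable {γ : ℝ}

lemma continuous_weight (γ : ℝ) : Continuous (weight γ) :=
  continuous_inv.comp (ENNReal.continuous_rpow_const.comp
    (ENNReal.continuous_ofReal.comp continuous_abs))

lemma weight_ne_zero (hγ : 0 ≤ γ) (b : ℝ) : weight γ b ≠ 0 :=
  ENNReal.inv_ne_zero.2 (ENNReal.rpow_ne_top_of_nonneg hγ ENNReal.ofReal_ne_top)

lemma weight_zero (hγ : 0 < γ) : weight γ 0 = ∞ := by
  simp [weight, hγ]

lemma weight_ne_top {b : ℝ} (hb : b ≠ 0) : weight γ b ≠ ∞ := by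
  simp [weight, hb]

lemma toReal_weight (γ b : ℝ) : (weight γ b).toReal = (|b| ^ γ)⁻¹ := by
  rw [weight, ENNReal.toReal_inv, ← ENNReal.toReal_rpow, ENNReal.toReal_ofReal (abs_nonneg b)]

lemma weight_inv_mul (hγ : 0 ≤ γ) {r : ℝ} (hr : 0 < r) (b : ℝ) :
    weight γ (r⁻¹ * b) = ENNReal.ofReal (r ^ γ) * weight γ b := by
  have hfactor : ENNReal.ofReal |r⁻¹ * b| = ENNReal.ofReal |b| / ENNReal.ofReal r := by
    rw [abs_mul, abs_of_pos (inv_pos.2 hr), inv_mul_eq_div, ENNReal.ofReal_div_of_pos hr]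
  rw [weight, weight, hfactor, ENNReal.div_rpow_of_nonneg _ _ hγ, ENNReal.ofReal_rpow_of_pos hr,
    ENNReal.inv_div (.inl ENNReal.ofReal_ne_top) (.inl (by positivity)), div_eq_mul_inv]

variable {p : ℕ} {βs : EuclideanSpace ℝ (Fin p)} {ι : Type*} {l : Filter ι}
  {b : ι → EuclideanSpace ℝ (Fin p)}

lemma tendsto_weight_apply (hb : Tendsto b l (𝓝 βs)) (j : Fin p) :
    Tendsto (fun i => weight γ (b i j)) l (𝓝 (weight γ (βs j))) :=
  (((continuous_weight γ).comp (EuclideanSpace.proj j : _ →L[ℝ] ℝ).continuous).tendsto βs).comp hb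

lemma eventually_weight_ne_top (hb : Tendsto b l (𝓝 βs)) :
    ∀ᶠ i in l, ∀ j ∈ activeSet βs, weight γ (b i j) ≠ ∞ :=
  (eventually_all_finset _).2 fun j hj =>
    (tendsto_weight_apply hb j).eventually_ne (weight_ne_top (mem_activeSet.1 hj))

lemma tendsto_toReal_weight_apply (hb : Tendsto b l (𝓝 βs)) {j : Fin p} (hj : j ∈ activeSet βs) :
    Tendsto (fun i => (weight γ (b i j)).toReal) l (𝓝 (|βs j| ^ γ)⁻¹) := by
  rw [← toReal_weight]
  exact (ENNReal.tendsto_toReal (weight_ne_top (mem_activeSet.1 hj))).comp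
    (tendsto_weight_apply hb j)

end Weights

section Rates

variable {γ : ℝ} {lam m : ℕ → ℝ}

lemma tendsto_natCast_atTop_of_div {m : ℕ → ℕ} (hm : ∀ᶠ n in atTop, 0 < m n) {r₀ : ℝ}
    (hr₀ : 0 ≤ r₀) (hmr : Tendsto (fun n : ℕ => (n : ℝ) / (m n : ℝ)) atTop (𝓝 r₀)) :
    Tendsto (fun n => (m n : ℝ)) atTop atTop := by
  have hdiv : Tendsto (fun n : ℕ => (n : ℝ) / (r₀ + 1)) atTop atTop :=
    tendsto_natCast_atTop_atTop.atTop_div_const (by positivity)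
  refine tendsto_atTop_mono' _ ?_ hdiv
  filter_upwards [hm, hmr.eventually_lt_const (lt_add_one r₀)] with n hn h
  rw [div_lt_iff₀ (by exact_mod_cast hn)] at h
  rw [div_le_iff₀ (by positivity)]
  linarith

lemma tendsto_inv_sqrt (hm : Tendsto m atTop atTop) :
    Tendsto (fun n => (√(m n))⁻¹) atTop (𝓝 0) :=
  (Real.tendsto_sqrt_atTop.comp hm).inv_tendsto_atTop

lemma tendsto_div_sqrt_zero (hγ : 0 < γ) {lam₁ : ℝ} (hm : Tendsto m atTop atTop)
    (hlam : Tendsto (fun n : ℕ => √(m n ^ γ / (n : ℝ)) * lam n) atTop (𝓝 lam₁)) :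
    Tendsto (fun n : ℕ => lam n / √(n : ℝ)) atTop (𝓝 0) := by
  have hprod := hlam.mul (tendsto_inv_sqrt ((tendsto_rpow_atTop hγ).comp hm))
  rw [mul_zero] at hprod
  refine hprod.congr' ?_
  filter_upwards [hm.eventually_gt_atTop 0] with n hn
  have hpos : √(m n ^ γ) ≠ 0 := (Real.sqrt_pos.2 (by positivity)).ne'
  rw [Real.sqrt_div (by positivity), Function.comp_apply]
  field_simp

lemma tendsto_ofReal_div_sqrt_mul_weight (hγ : 0 ≤ γ) (hm : Tendsto m atTop atTop)
    (hlam : ∀ n, 0 ≤ lam n) {L : ℝ≥0∞}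
    (hL : Tendsto (fun n : ℕ => ENNReal.ofReal (√(m n ^ γ / (n : ℝ)) * lam n)) atTop (𝓝 L))
    {s : ℝ} (hs : L ≠ 0 ∨ s ≠ 0) :
    Tendsto (fun q : ℕ × ℝ => ENNReal.ofReal (lam q.1 / √(q.1 : ℝ)) *
      weight γ ((√(m q.1))⁻¹ * q.2)) (atTop ×ˢ 𝓝 s) (𝓝 (L * weight γ s)) := by
  have hprod : Tendsto (fun q : ℕ × ℝ => ENNReal.ofReal (√(m q.1 ^ γ / (q.1 : ℝ)) * lam q.1) *
      weight γ q.2) (atTop ×ˢ 𝓝 s) (𝓝 (L * weight γ s)) :=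
    ENNReal.Tendsto.mul (hL.comp tendsto_fst) (hs.imp_right weight_ne_top)
      (((continuous_weight γ).tendsto s).comp tendsto_snd) (.inl (weight_ne_zero hγ s))
  refine hprod.congr' ?_
  filter_upwards [tendsto_fst.eventually (hm.eventually_gt_atTop 0)] with q hq
  have hsqrt : √(m q.1 ^ γ) = √(m q.1) ^ γ := by
    rw [Real.sqrt_eq_rpow, Real.sqrt_eq_rpow, ← Real.rpow_mul hq.le, ← Real.rpow_mul hq.le,
      mul_comm]
  rw [weight_inv_mul hγ (Real.sqrt_pos.2 hq), ← mul_assoc,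
    ← ENNReal.ofReal_mul (div_nonneg (hlam _) (Real.sqrt_nonneg _)),
    Real.sqrt_div (by positivity), hsqrt]
  congr 2
  ring

lemma tendsto_weight_inv_sqrt_mul_atTop (hγ : 0 < γ) (hm : Tendsto m atTop atTop) (s : ℝ) :
    Tendsto (fun q : ℕ × ℝ => weight γ ((√(m q.1))⁻¹ * q.2)) (atTop ×ˢ 𝓝 s) (𝓝 ∞) := by
  have hzero : Tendsto (fun q : ℕ × ℝ => (√(m q.1))⁻¹ * q.2) (atTop ×ˢ 𝓝 s) (𝓝 0) := by
    simpa only [zero_mul, Function.comp_apply] using ((tendsto_inv_sqrt hm).comp tendsto_fst).mul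
      (tendsto_snd (f := atTop) (g := 𝓝 s))
  exact weight_zero hγ ▸ ((continuous_weight γ).tendsto 0).comp hzero

end Rates

section Asymptotics

variable {p : ℕ} {βs : EuclideanSpace ℝ (Fin p)} {γ : ℝ}
  {X : (n : ℕ) → Matrix (Fin n) (Fin p) ℝ} {C : Matrix (Fin p) (Fin p) ℝ} {m lam t : ℕ → ℝ}

/-- The local problem of the `n`-th experiment at step `t n`, as a function of its random data:
the score `n ^ (-1/2) Xᵀ ε` and the rescaled error `√m (βt - βs)` of the initial estimator. -/
noncomputable def localProblem (βs : EuclideanSpace ℝ (Fin p)) (γ : ℝ)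
    (X : (n : ℕ) → Matrix (Fin n) (Fin p) ℝ) (m lam t : ℕ → ℝ) (n : ℕ)
    (d : EuclideanSpace ℝ (Fin p) × EuclideanSpace ℝ (Fin p)) : EuclideanSpace ℝ (Fin p) → EReal :=
  localObjective βs ((1 / (n : ℝ)) • ((X n)ᵀ * X n)) ((√(n : ℝ) * t n)⁻¹ • d.1) (t n)
    (fun j => lam n / (n * t n) * (weight γ ((βs + (√(m n))⁻¹ • d.2) j)).toReal)
    (fun j => ENNReal.ofReal (lam n / (n * t n)) * weight γ ((βs + (√(m n))⁻¹ • d.2) j))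

lemma tendsto_add_inv_sqrt_smul (hm : Tendsto m atTop atTop)
    (d : EuclideanSpace ℝ (Fin p) × EuclideanSpace ℝ (Fin p)) :
    Tendsto (fun q : ℕ × EuclideanSpace ℝ (Fin p) × EuclideanSpace ℝ (Fin p) =>
      βs + (√(m q.1))⁻¹ • q.2.2) (atTop ×ˢ 𝓝 d) (𝓝 βs) := by
  have hsmul := ((tendsto_inv_sqrt hm).comp tendsto_fst).smul
    ((continuous_snd.tendsto d).comp (tendsto_snd (f := (atTop : Filter ℕ))))
  simpa only [zero_smul, add_zero, Function.comp_apply] using hsmul.const_add βs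

theorem eventually_isArgmin_localProblem_mem (hC : C.PosDef)
    (hXC : Tendsto (fun n : ℕ => (1 / (n : ℝ)) • ((X n)ᵀ * X n)) atTop (𝓝 C))
    (hm : Tendsto m atTop atTop) (ht : Tendsto t atTop (𝓝 0)) {κ r : ℝ}
    (hκ : Tendsto (fun n : ℕ => lam n / (n * t n)) atTop (𝓝 κ))
    (hr : Tendsto (fun n : ℕ => (√(n : ℝ) * t n)⁻¹) atTop (𝓝 r)) {c : Fin p → ℝ≥0∞}
    {d : EuclideanSpace ℝ (Fin p) × EuclideanSpace ℝ (Fin p)}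
    (hc : ∀ j ∉ activeSet βs, Tendsto
      (fun q : ℕ × ℝ => ENNReal.ofReal (lam q.1 / (q.1 * t q.1)) *
        weight γ ((√(m q.1))⁻¹ * q.2)) (atTop ×ˢ 𝓝 (d.2 j)) (𝓝 (c j)))
    {V : Set (EuclideanSpace ℝ (Fin p))}
    (hV : V ∈ 𝓝 (limitArgmin βs hC (fun j => κ * (|βs j| ^ γ)⁻¹) (r • d.1) c)) :
    ∀ᶠ q in atTop ×ˢ 𝓝 d, ∀ u,
      IsArgmin (localProblem βs γ X m lam t q.1 q.2) Set.univ u → u ∈ V := by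
  have hscore : Tendsto (fun q : ℕ × EuclideanSpace ℝ (Fin p) × EuclideanSpace ℝ (Fin p) =>
      (√(q.1 : ℝ) * t q.1)⁻¹ • q.2.1) (atTop ×ˢ 𝓝 d) (𝓝 (r • d.1)) :=
    (hr.comp tendsto_fst).smul ((continuous_fst.tendsto d).comp tendsto_snd)
  have hactive : ∀ j ∈ activeSet βs, Tendsto
      (fun q : ℕ × EuclideanSpace ℝ (Fin p) × EuclideanSpace ℝ (Fin p) => lam q.1 / (q.1 * t q.1) *
        (weight γ ((βs + (√(m q.1))⁻¹ • q.2.2) j)).toReal) (atTop ×ˢ 𝓝 d)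
      (𝓝 (κ * (|βs j| ^ γ)⁻¹)) := fun j hj =>
    (hκ.comp tendsto_fst).mul (tendsto_toReal_weight_apply (tendsto_add_inv_sqrt_smul hm d) hj)
  refine eventually_isArgmin_localObjective_mem hC (hXC.comp tendsto_fst) hscore
    (ht.comp tendsto_fst) hactive (fun j hj => ?_) (isUniqueArgmin_limitArgmin hC) hV
  have hj' : j ∉ activeSet βs := Finset.mem_compl.1 hj
  have hβsj : βs j = 0 := by simpa only [mem_activeSet, not_not] using hj'
  have hdj : Tendsto (fun q : ℕ × EuclideanSpace ℝ (Fin p) × EuclideanSpace ℝ (Fin p) =>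
      (q.1, q.2.2 j)) (atTop ×ˢ 𝓝 d) (atTop ×ˢ 𝓝 (d.2 j)) :=
    tendsto_fst.prodMk ((((EuclideanSpace.proj j : _ →L[ℝ] ℝ).continuous.comp
      continuous_snd).tendsto d).comp tendsto_snd)
  simpa [hβsj, Function.comp_def] using (hc j hj').comp hdj

lemma aemeasurable_limitArgmin (hC : C.PosDef) (a : Fin p → ℝ) {Ω : Type*} [MeasurableSpace Ω]
    {Q : Measure Ω} {W z : Ω → EuclideanSpace ℝ (Fin p)} (hW : AEMeasurable W Q)
    (hz : AEMeasurable z Q) {c : ℝ → ℝ≥0∞} (hc : Continuous c) :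
    AEMeasurable (fun ω => limitArgmin βs hC a (W ω) fun j => c (z ω j)) Q := by
  have hweights : Measurable fun x : EuclideanSpace ℝ (Fin p) => fun j => c (x j) :=
    measurable_pi_lambda _ fun j => hc.measurable.comp (by fun_prop)
  have hdata : AEMeasurable (fun ω => (W ω, fun j => c (z ω j))) Q :=
    hW.prodMk (hweights.comp_aemeasurable hz)
  simpa only [Function.comp_def] using
    (continuous_limitArgmin (βs := βs) (a := a) hC).measurable.comp_aemeasurable hdata

lemma isArgmin_localProblem_of_objective {n : ℕ} (hn : 0 < n) (hm : 0 < m n) (hlam : 0 ≤ lam n)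
    (ht : 0 < t n) {βt β : EuclideanSpace ℝ (Fin p)} {e : Fin n → ℝ}
    (hβt : ∀ j ∈ activeSet βs, weight γ (βt j) ≠ ∞)
    (h : IsArgmin (objective (X n) (X n *ᵥ βs.ofLp + e) (lam n) γ βt) Set.univ β) :
    IsArgmin (localProblem βs γ X m lam t n
      (WithLp.toLp 2 (((√(n : ℝ))⁻¹ • (X n)ᵀ) *ᵥ e), √(m n) • (βt - βs))) Set.univ
      ((t n)⁻¹ • (β - βs)) := by
  have hβt_eq : βs + (√(m n))⁻¹ • √(m n) • (βt - βs) = βt := by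
    rw [inv_smul_smul₀ (Real.sqrt_pos.2 hm).ne', add_sub_cancel]
  have hβ_eq : βs + t n • (t n)⁻¹ • (β - βs) = β := by
    rw [smul_inv_smul₀ ht.ne', add_sub_cancel]
  have hscore : (√(n : ℝ) * t n)⁻¹ • WithLp.toLp 2 (((√(n : ℝ))⁻¹ • (X n)ᵀ) *ᵥ e) =
      WithLp.toLp 2 ((n * t n)⁻¹ • (X n)ᵀ *ᵥ e) := by
    rw [Matrix.smul_mulVec, WithLp.toLp_smul, WithLp.toLp_smul, smul_smul, ← mul_inv,
      mul_right_comm, Real.mul_self_sqrt (Nat.cast_nonneg n)]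
  rw [localProblem, hβt_eq, hscore]
  exact isArgmin_localObjective_of_objective hn hlam ht hβt (hβ_eq.symm ▸ h)

variable {Ω : ℕ → Type*} [∀ n, MeasurableSpace (Ω n)] {P : (n : ℕ) → Measure (Ω n)}
  [∀ n, IsProbabilityMeasure (P n)] {ε : (n : ℕ) → Ω n → Fin n → ℝ}
  {βt βh : (n : ℕ) → Ω n → EuclideanSpace ℝ (Fin p)}
  {Ω' : Type*} [MeasurableSpace Ω'] {Q : Measure Ω'} [IsProbabilityMeasure Q]
  {W z : Ω' → EuclideanSpace ℝ (Fin p)}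

/-- Adaptive Lasso estimators `βh` in a sequence of linear models with design `X`, noise `ε` and
initial estimators `βt` of rate `√m`. Of the noise and the initial estimators only the joint limit
`(W, z)` of the score and the rescaled error is prescribed. -/
structure AsymptoticSetting (βs : EuclideanSpace ℝ (Fin p)) (γ : ℝ)
    (X : (n : ℕ) → Matrix (Fin n) (Fin p) ℝ) (C : Matrix (Fin p) (Fin p) ℝ) (m lam : ℕ → ℝ)
    (P : (n : ℕ) → Measure (Ω n)) [∀ n, IsProbabilityMeasure (P n)]
    (ε : (n : ℕ) → Ω n → Fin n → ℝ) (βt βh : (n : ℕ) → Ω n → EuclideanSpace ℝ (Fin p))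
    (Q : Measure Ω') [IsProbabilityMeasure Q] (W z : Ω' → EuclideanSpace ℝ (Fin p)) : Prop where
  gamma_pos : 0 < γ
  posDef : C.PosDef
  tendsto_gram : Tendsto (fun n : ℕ => (1 / (n : ℝ)) • ((X n)ᵀ * X n)) atTop (𝓝 C)
  tendsto_rate : Tendsto m atTop atTop
  lam_nonneg : ∀ n, 0 ≤ lam n
  tendsto_data : TendstoInDistribution (fun (n : ℕ) ω =>
    (WithLp.toLp 2 (((√(n : ℝ))⁻¹ • (X n)ᵀ) *ᵥ ε n ω), √(m n) • (βt n ω - βs))) atTop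
    (fun ω => (W ω, z ω)) P Q
  aemeasurable_estimator : ∀ n, AEMeasurable (βh n) (P n)
  isArgmin_estimator : ∀ n, ∀ᵐ ω ∂(P n),
    IsArgmin (objective (X n) (X n *ᵥ βs.ofLp + ε n ω) (lam n) γ (βt n ω)) Set.univ (βh n ω)

namespace AsymptoticSetting

theorem of_iIndepFun_gaussianReal {v : ℝ≥0} (hγ : 0 < γ) (hC : C.PosDef)
    (hXC : Tendsto (fun n : ℕ => (1 / (n : ℝ)) • ((X n)ᵀ * X n)) atTop (𝓝 C))
    (hm : Tendsto m atTop atTop) (hlam : ∀ n, 0 ≤ lam n)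
    (hindep : ∀ n, iIndepFun (fun i ω => ε n ω i) (P n))
    (hlaw : ∀ n i, HasLaw (fun ω => ε n ω i) (gaussianReal 0 v) (P n))
    (hβtε : ∀ n, IndepFun (βt n) (ε n) (P n))
    (hW : HasLaw W (multivariateGaussian 0 ((v : ℝ) • C)) Q) (hWz : IndepFun W z Q)
    (hz : TendstoInDistribution (fun n ω => √(m n) • (βt n ω - βs)) atTop z P Q)
    (hβh : ∀ n, AEMeasurable (βh n) (P n))
    (hargmin : ∀ n, ∀ᵐ ω ∂(P n), IsArgmin
      (objective (X n) (X n *ᵥ βs.ofLp + ε n ω) (lam n) γ (βt n ω)) Set.univ (βh n ω)) :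
    AsymptoticSetting βs γ X C m lam P ε βt βh Q W z := by
  have hgram : ∀ n : ℕ, (1 / (n : ℝ)) • ((X n)ᵀ * X n) =
      ((√(n : ℝ))⁻¹ • (X n)ᵀ) * ((√(n : ℝ))⁻¹ • (X n)ᵀ)ᵀ := fun n => by
    rw [Matrix.transpose_smul, Matrix.transpose_transpose, Matrix.smul_mul, Matrix.mul_smul,
      smul_smul, ← mul_inv, Real.mul_self_sqrt (Nat.cast_nonneg n), one_div]
  have hscore := tendstoInDistribution_toLp_mulVec_gaussian hC.posSemidef
    (hXC.congr hgram) hindep hlaw hW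
  exact ⟨hγ, hC, hXC, hm, hlam, tendstoInDistribution_prodMk_of_indepFun hscore hz
    (fun n => (hβtε n).symm.comp (continuous_toLp_mulVec _).measurable
      (ψ := fun b => √(m n) • (b - βs)) (by fun_prop)) hWz, hβh, hargmin⟩

variable (h : AsymptoticSetting βs γ X C m lam P ε βt βh Q W z)

include h

theorem tendstoInDistribution_limitArgmin (ht_pos : ∀ᶠ n in atTop, 0 < t n)
    (ht : Tendsto t atTop (𝓝 0)) {κ r : ℝ}
    (hκ : Tendsto (fun n : ℕ => lam n / (n * t n)) atTop (𝓝 κ))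
    (hr : Tendsto (fun n : ℕ => (√(n : ℝ) * t n)⁻¹) atTop (𝓝 r))
    {c : ℝ → ℝ≥0∞} (hc : Continuous c)
    (hlim : ∀ j ∉ activeSet βs, ∀ᵐ ω ∂Q, Tendsto
      (fun q : ℕ × ℝ => ENNReal.ofReal (lam q.1 / (q.1 * t q.1)) *
        weight γ ((√(m q.1))⁻¹ * q.2)) (atTop ×ˢ 𝓝 (z ω j)) (𝓝 (c (z ω j)))) :
    TendstoInDistribution (fun n ω => (t n)⁻¹ • (βh n ω - βs)) atTop
      (fun ω => limitArgmin βs h.posDef (fun j => κ * (|βs j| ^ γ)⁻¹) (r • W ω)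
        fun j => c (z ω j)) P Q := by
  have hdata := h.tendsto_data.aemeasurable_limit
  have hlim_all : ∀ᵐ ω ∂Q, ∀ j ∉ activeSet βs, Tendsto
      (fun q : ℕ × ℝ => ENNReal.ofReal (lam q.1 / (q.1 * t q.1)) *
        weight γ ((√(m q.1))⁻¹ * q.2)) (atTop ×ˢ 𝓝 (z ω j)) (𝓝 (c (z ω j))) :=
    ae_all_iff.2 fun j => eventually_imp_distrib_left.2 (hlim j)
  -- The relation is vacuous where a weight of an active coordinate is infinite, an event whose
  -- probability tends to zero.
  refine tendstoInDistribution_of_relation h.tendsto_data (fun n => ?_)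
    (aemeasurable_limitArgmin h.posDef _ (hdata.fst.const_smul r) hdata.snd hc)
    (R := fun n d u => (∀ j ∈ activeSet βs, weight γ ((βs + (√(m n))⁻¹ • d.2) j) ≠ ∞) →
      IsArgmin (localProblem βs γ X m lam t n d) Set.univ u) ?_ ?_
  · exact ((h.aemeasurable_estimator n).sub_const βs).const_smul (t n)⁻¹
  · filter_upwards [ht_pos, h.tendsto_rate.eventually_gt_atTop 0, eventually_gt_atTop 0]
      with n htn hmn hn
    filter_upwards [h.isArgmin_estimator n] with ω hω hfin
    rw [inv_smul_smul₀ (Real.sqrt_pos.2 hmn).ne', add_sub_cancel] at hfin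
    exact isArgmin_localProblem_of_objective hn hmn (h.lam_nonneg n) htn hfin hω
  · filter_upwards [hlim_all] with ω hω V hV
    filter_upwards [eventually_weight_ne_top (tendsto_add_inv_sqrt_smul h.tendsto_rate (W ω, z ω)),
      eventually_isArgmin_localProblem_mem h.posDef h.tendsto_gram h.tendsto_rate ht hκ hr hω hV]
      with q hfin hq u hu
    exact hq u (hu hfin)

theorem tendstoInDistribution_sqrt_smul {κ : ℝ}
    (hκ : Tendsto (fun n : ℕ => lam n / √(n : ℝ)) atTop (𝓝 κ)) {c : ℝ → ℝ≥0∞} (hc : Continuous c)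
    (hlim : ∀ j ∉ activeSet βs, ∀ᵐ ω ∂Q, Tendsto
      (fun q : ℕ × ℝ => ENNReal.ofReal (lam q.1 / √(q.1 : ℝ)) *
        weight γ ((√(m q.1))⁻¹ * q.2)) (atTop ×ˢ 𝓝 (z ω j)) (𝓝 (c (z ω j)))) :
    TendstoInDistribution (fun (n : ℕ) ω => √(n : ℝ) • (βh n ω - βs)) atTop
      (fun ω => limitArgmin βs h.posDef (fun j => κ * (|βs j| ^ γ)⁻¹) (W ω)
        fun j => c (z ω j)) P Q := by
  have hstep : ∀ n : ℕ, (n : ℝ) * (√(n : ℝ))⁻¹ = √(n : ℝ) := fun n => by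
    rw [← div_eq_mul_inv, Real.div_sqrt]
  have hsqrt_pos : ∀ᶠ n : ℕ in atTop, 0 < √(n : ℝ) :=
    (eventually_gt_atTop 0).mono fun n hn => Real.sqrt_pos.2 (by exact_mod_cast hn)
  have hone : Tendsto (fun n : ℕ => (√(n : ℝ) * (√(n : ℝ))⁻¹)⁻¹) atTop (𝓝 1) :=
    tendsto_const_nhds.congr' <| hsqrt_pos.mono fun n hn => by
      simp only [mul_inv_cancel₀ hn.ne', inv_one]
  simpa only [inv_inv, one_smul] using h.tendstoInDistribution_limitArgmin
    (t := fun n => (√(n : ℝ))⁻¹) (hsqrt_pos.mono fun n hn => inv_pos.2 hn)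
    (tendsto_inv_sqrt tendsto_natCast_atTop_atTop) (by simpa only [hstep] using hκ) hone hc
    (by simpa only [hstep] using hlim)

theorem exists_isUniqueArgmin_limitSmall {lam₁ : ℝ}
    (hz : lam₁ = 0 → ∀ j ∉ activeSet βs, ∀ᵐ ω ∂Q, z ω j ≠ 0)
    (hlam : Tendsto (fun n : ℕ => √(m n ^ γ / (n : ℝ)) * lam n) atTop (𝓝 lam₁)) :
    ∃ U : Ω' → EuclideanSpace ℝ (Fin p),
      (∀ᵐ ω ∂Q, IsUniqueArgmin (limitSmall C βs lam₁ γ (W ω) (z ω)) Set.univ (U ω)) ∧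
      TendstoInDistribution (fun (n : ℕ) ω => √(n : ℝ) • (βh n ω - βs)) atTop U P Q := by
  have hlam₁ : 0 ≤ lam₁ :=
    ge_of_tendsto' hlam fun n => mul_nonneg (Real.sqrt_nonneg _) (h.lam_nonneg n)
  have hcont : Continuous fun s => ENNReal.ofReal lam₁ * weight γ s :=
    (ENNReal.continuous_const_mul ENNReal.ofReal_ne_top).comp (continuous_weight γ)
  have hnondeg : ∀ j ∉ activeSet βs, ∀ᵐ ω ∂Q, ENNReal.ofReal lam₁ ≠ 0 ∨ z ω j ≠ 0 := by
    rcases hlam₁.eq_or_lt with heq | hlt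
    · exact fun j hj => (hz heq.symm j hj).mono fun ω => Or.inr
    · exact fun _ _ => .of_forall fun _ => Or.inl (ENNReal.ofReal_pos.2 hlt).ne'
  have hlaw := h.tendstoInDistribution_sqrt_smul
    (tendsto_div_sqrt_zero h.gamma_pos h.tendsto_rate hlam) hcont fun j hj =>
      (hnondeg j hj).mono fun ω hω => tendsto_ofReal_div_sqrt_mul_weight h.gamma_pos.le
        h.tendsto_rate h.lam_nonneg (ENNReal.tendsto_ofReal hlam) hω
  refine ⟨_, .of_forall fun ω => ?_, hlaw⟩
  rw [limitSmall_eq_localObjective]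
  simpa only [zero_mul, Pi.zero_def] using isUniqueArgmin_limitArgmin h.posDef

theorem exists_isUniqueArgmin_activeSubspace {lam₀ : ℝ}
    (hlam : Tendsto (fun n : ℕ => √(m n ^ γ / (n : ℝ)) * lam n) atTop atTop)
    (hlam₀ : Tendsto (fun n : ℕ => lam n / √(n : ℝ)) atTop (𝓝 lam₀)) :
    ∃ U : Ω' → EuclideanSpace ℝ (Fin p),
      (∀ᵐ ω ∂Q, IsUniqueArgmin (fun u => quad C (W ω) u + lam₀ * activeDrift βs γ u)
        (activeSubspace βs) (U ω)) ∧
      TendstoInDistribution (fun (n : ℕ) ω => √(n : ℝ) • (βh n ω - βs)) atTop U P Q := by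
  have hlaw := h.tendstoInDistribution_sqrt_smul hlam₀ (c := fun _ => ∞) continuous_const
    fun j _ => .of_forall fun ω => by
      simpa only [ENNReal.top_mul (weight_ne_zero h.gamma_pos.le _)] using
        tendsto_ofReal_div_sqrt_mul_weight h.gamma_pos.le h.tendsto_rate h.lam_nonneg
          (ENNReal.tendsto_ofReal_atTop.comp hlam) (s := z ω j) (.inl ENNReal.top_ne_zero)
  exact ⟨_, .of_forall fun ω => isUniqueArgmin_activeSubspace (isUniqueArgmin_limitArgmin h.posDef),
    hlaw⟩

theorem exists_isUniqueArgmin_activeSubspace_zero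
    (hlam : Tendsto (fun n : ℕ => lam n / √(n : ℝ)) atTop atTop)
    (hlam_zero : Tendsto (fun n : ℕ => lam n / (n : ℝ)) atTop (𝓝 0)) :
    ∃ u₀ : EuclideanSpace ℝ (Fin p),
      IsUniqueArgmin (fun u => quad C 0 u + activeDrift βs γ u) (activeSubspace βs) u₀ ∧
      TendstoInDistribution (fun (n : ℕ) ω => ((n : ℝ) / lam n) • (βh n ω - βs)) atTop
        (fun _ => u₀) P Q := by
  have hpos : ∀ᶠ n : ℕ in atTop, 0 < lam n / (n : ℝ) := by
    filter_upwards [hlam.eventually_gt_atTop 0, eventually_gt_atTop 0] with n hn_lam hn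
    have hn' : (0 : ℝ) < n := by exact_mod_cast hn
    exact div_pos ((div_pos_iff_of_pos_right (Real.sqrt_pos.2 hn')).1 hn_lam) hn'
  have hκ : ∀ᶠ n : ℕ in atTop, lam n / (n * (lam n / n)) = 1 := by
    filter_upwards [hpos] with n hn_pos
    rw [← div_div, div_self hn_pos.ne']
  have hr : Tendsto (fun n : ℕ => (√(n : ℝ) * (lam n / n))⁻¹) atTop (𝓝 0) :=
    hlam.inv_tendsto_atTop.congr fun n => by
      rw [Pi.inv_apply, mul_div_left_comm, Real.sqrt_div_self', mul_one_div]
  have hlaw := h.tendstoInDistribution_limitArgmin hpos hlam_zero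
    (tendsto_const_nhds.congr' (hκ.mono fun n => Eq.symm)) hr (c := fun _ => ∞) continuous_const
    fun j _ => .of_forall fun ω => by
      refine (tendsto_weight_inv_sqrt_mul_atTop h.gamma_pos h.tendsto_rate (z ω j)).congr' ?_
      filter_upwards [tendsto_fst.eventually hκ] with q hq
      rw [hq, ENNReal.ofReal_one, one_mul]
  simp only [inv_div, zero_smul] at hlaw
  exact ⟨_, by simpa only [one_mul] using
    isUniqueArgmin_activeSubspace (κ := 1) (isUniqueArgmin_limitArgmin h.posDef), hlaw⟩

end AsymptoticSetting

end Asymptotics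

end AdaptiveLasso

theorem mainTheorem10_general {p : ℕ} {βs : EuclideanSpace ℝ (Fin p)} {γ : ℝ}
    {X : (n : ℕ) → Matrix (Fin n) (Fin p) ℝ} {C : Matrix (Fin p) (Fin p) ℝ} {m lam : ℕ → ℝ}
    {Ω : ℕ → Type*} [∀ n, MeasurableSpace (Ω n)] {P : (n : ℕ) → Measure (Ω n)}
    [∀ n, IsProbabilityMeasure (P n)] {ε : (n : ℕ) → Ω n → Fin n → ℝ}
    {βt βh : (n : ℕ) → Ω n → EuclideanSpace ℝ (Fin p)}
    {Ω' : Type*} [MeasurableSpace Ω'] {Q : Measure Ω'} [IsProbabilityMeasure Q]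
    {W z : Ω' → EuclideanSpace ℝ (Fin p)}
    (h : AdaptiveLasso.AsymptoticSetting βs γ X C m lam P ε βt βh Q W z) :
    (∀ lam₁ : ℝ, (lam₁ = 0 → ∀ j, j ∉ AdaptiveLasso.activeSet βs → ∀ᵐ ω ∂Q, z ω j ≠ 0) →
      Tendsto (fun n : ℕ => √(m n ^ γ / (n : ℝ)) * lam n) atTop (𝓝 lam₁) →
      ∃ U : Ω' → EuclideanSpace ℝ (Fin p),
        (∀ᵐ ω ∂Q, AdaptiveLasso.IsUniqueArgmin
          (AdaptiveLasso.limitSmall C βs lam₁ γ (W ω) (z ω)) Set.univ (U ω)) ∧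
        TendstoInDistribution (fun (n : ℕ) ω => √(n : ℝ) • (βh n ω - βs)) atTop U P Q) ∧
    (∀ lam₀ : ℝ, Tendsto (fun n : ℕ => √(m n ^ γ / (n : ℝ)) * lam n) atTop atTop →
      Tendsto (fun n : ℕ => lam n / √(n : ℝ)) atTop (𝓝 lam₀) →
      ∃ U : Ω' → EuclideanSpace ℝ (Fin p),
        (∀ᵐ ω ∂Q, AdaptiveLasso.IsUniqueArgmin
          (fun u => AdaptiveLasso.quad C (W ω) u + lam₀ * AdaptiveLasso.activeDrift βs γ u)
          (AdaptiveLasso.activeSubspace βs) (U ω)) ∧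
        TendstoInDistribution (fun (n : ℕ) ω => √(n : ℝ) • (βh n ω - βs)) atTop U P Q) ∧
    (Tendsto (fun n : ℕ => lam n / √(n : ℝ)) atTop atTop →
      Tendsto (fun n : ℕ => lam n / (n : ℝ)) atTop (𝓝 0) →
      ∃ u₀ : EuclideanSpace ℝ (Fin p),
        AdaptiveLasso.IsUniqueArgmin
          (fun u => AdaptiveLasso.quad C 0 u + AdaptiveLasso.activeDrift βs γ u)
          (AdaptiveLasso.activeSubspace βs) u₀ ∧
        TendstoInDistribution (fun (n : ℕ) ω => ((n : ℝ) / lam n) • (βh n ω - βs)) atTop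
          (fun _ => u₀) P Q) :=
  ⟨fun _ => h.exists_isUniqueArgmin_limitSmall, fun _ => h.exists_isUniqueArgmin_activeSubspace,
    h.exists_isUniqueArgmin_activeSubspace_zero⟩

theorem mainTheorem10 {p : ℕ}
    -- true parameter, noise level, exponent
    (βs : EuclideanSpace ℝ (Fin p)) (σ : ℝ≥0) (γ : ℝ) (hγ : 0 < γ)
    -- design matrices with `n` rows
    (X : (n : ℕ) → Matrix (Fin n) (Fin p) ℝ) (C : Matrix (Fin p) (Fin p) ℝ) (hC : C.PosDef)
    (hXC : Tendsto (fun n : ℕ => (1 / (n : ℝ)) • ((X n)ᵀ * X n)) atTop (𝓝 C))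
    (hXmax : Tendsto (fun n : ℕ => 1 / (n : ℝ) * ⨆ i, ∑ j, X n i j ^ 2) atTop (𝓝 0))
    -- source sample sizes
    (m : ℕ → ℕ) (hm : ∀ᶠ n in atTop, 0 < m n) (r₀ : ℝ) (hr₀ : 0 ≤ r₀)
    (hmr : Tendsto (fun n : ℕ => (n : ℝ) / (m n : ℝ)) atTop (𝓝 r₀))
    -- regularization parameters
    (lam : ℕ → ℝ) (hlam : ∀ n, 0 ≤ lam n)
    -- the probability space of the `n`-th experiment, with i.i.d. Gaussian noise
    {Ω : ℕ → Type*} [∀ n, MeasurableSpace (Ω n)] (P : (n : ℕ) → Measure (Ω n))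
    [∀ n, IsProbabilityMeasure (P n)]
    (ε : (n : ℕ) → Ω n → Fin n → ℝ)
    (hε_indep : ∀ n, iIndepFun (fun i ω => ε n ω i) (P n))
    (hε_law : ∀ n i, HasLaw (fun ω => ε n ω i) (gaussianReal 0 (σ ^ 2)) (P n))
    -- the initial estimator, independent of the target data
    (βt : (n : ℕ) → Ω n → EuclideanSpace ℝ (Fin p))
    (hβt : ∀ n, AEMeasurable (βt n) (P n))
    (hβtε : ∀ n, IndepFun (βt n) (ε n) (P n))
    -- the limit variables `W ∼ N(0, σ² C)` and `z`, independent of each other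
    {Ω' : Type*} [MeasurableSpace Ω'] (Q : Measure Ω') [IsProbabilityMeasure Q]
    (W z : Ω' → EuclideanSpace ℝ (Fin p))
    (hW : HasLaw W (multivariateGaussian 0 (((σ : ℝ) ^ 2) • C)) Q)
    (hWz : IndepFun W z Q)
    (hz : TendstoInDistribution
      (fun n ω => √(m n : ℝ) • (βt n ω - βs)) atTop z P Q)
    -- an Adaptive Lasso estimator for the response `y = X βs + ε`
    (βh : (n : ℕ) → Ω n → EuclideanSpace ℝ (Fin p))
    (hβh_meas : ∀ n, AEMeasurable (βh n) (P n))
    (hβh : ∀ n, ∀ᵐ ω ∂(P n), AdaptiveLasso.IsArgmin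
      (AdaptiveLasso.objective (X n) (X n *ᵥ βs.ofLp + ε n ω) (lam n) γ (βt n ω))
      Set.univ (βh n ω)) :
    -- (i)
    (∀ lam₁ : ℝ, 0 ≤ lam₁ →
      (lam₁ = 0 → ∀ j, j ∉ AdaptiveLasso.activeSet βs → ∀ᵐ ω ∂Q, z ω j ≠ 0) →
      Tendsto (fun n : ℕ => √((m n : ℝ) ^ γ / (n : ℝ)) * lam n) atTop (𝓝 lam₁) →
      ∃ U : Ω' → EuclideanSpace ℝ (Fin p),
        (∀ᵐ ω ∂Q, AdaptiveLasso.IsUniqueArgmin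
          (AdaptiveLasso.limitSmall C βs lam₁ γ (W ω) (z ω)) Set.univ (U ω)) ∧
        TendstoInDistribution (fun (n : ℕ) ω => √(n : ℝ) • (βh n ω - βs)) atTop U P Q) ∧
    -- (ii)
    (∀ lam₀ : ℝ, 0 ≤ lam₀ →
      Tendsto (fun n : ℕ => √((m n : ℝ) ^ γ / (n : ℝ)) * lam n) atTop atTop →
      Tendsto (fun n : ℕ => lam n / √(n : ℝ)) atTop (𝓝 lam₀) →
      ∃ U : Ω' → EuclideanSpace ℝ (Fin p),
        (∀ᵐ ω ∂Q, AdaptiveLasso.IsUniqueArgmin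
          (fun u => AdaptiveLasso.quad C (W ω) u + lam₀ * AdaptiveLasso.activeDrift βs γ u)
          (AdaptiveLasso.activeSubspace βs) (U ω)) ∧
        TendstoInDistribution (fun (n : ℕ) ω => √(n : ℝ) • (βh n ω - βs)) atTop U P Q) ∧
    -- (iii)
    (Tendsto (fun n : ℕ => lam n / √(n : ℝ)) atTop atTop →
      Tendsto (fun n : ℕ => lam n / (n : ℝ)) atTop (𝓝 0) →
      ∃ u₀ : EuclideanSpace ℝ (Fin p),
        AdaptiveLasso.IsUniqueArgmin
          (fun u => AdaptiveLasso.quad C 0 u + AdaptiveLasso.activeDrift βs γ u)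
          (AdaptiveLasso.activeSubspace βs) u₀ ∧
        TendstoInDistribution (fun (n : ℕ) ω => ((n : ℝ) / lam n) • (βh n ω - βs)) atTop
          (fun _ => u₀) P Q) := by
  obtain ⟨hi, hii, hiii⟩ := mainTheorem10_general <|
    AdaptiveLasso.AsymptoticSetting.of_iIndepFun_gaussianReal hγ hC hXC
      (AdaptiveLasso.tendsto_natCast_atTop_of_div hm hr₀ hmr) hlam hε_indep hε_law hβtε
      (by simpa only [NNReal.coe_pow] using hW) hWz hz hβh_meas hβh
  exact ⟨fun lam₁ _ => hi lam₁, fun lam₀ _ => hii lam₀, hiii⟩
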